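/- Let $R$ be a commutative Noetherian ring, $A$ an $R$-algebra that is finitely generated and projective as an $R$-module, $\Lambda$ a poset, and $\{\Delta(\lambda)\}_{\lambda\in\Lambda}$ a family of finitely generated left $A$-modules. Write $D=\operatorname{Hom}_R(-,R)$. For an $A$-module $M$, $\operatorname{add}_A M$ is the class of all $A$-modules isomorphic to direct summands of finite direct sums of copies of $M$. The pair $(A,\{\Delta(\lambda)\}_{\lambda\in\Lambda})$ is called a \emph{split quasi-hereditary $R$-algebra} if: (1) each $\Delta(\lambda)$ is projective over $R$; (2) $\operatorname{Hom}_A(\Delta(\lambda),\Delta(\mu))\neq 0$ implies $\lambda\le\mu$; (3) $\operatorname{End}_A(\Delta(\lambda))\simeq R$ as $R$-algebras for all $\lambda\in\Lambda$; (4) for each $\lambda\in\Lambda$ there are a finitely generated projective $A$-module $P(\lambda)$ and an exact sequence $0\to C(\lambda)\to P(\lambda)\to\Delta(\lambda)\to 0$ such that $C(\lambda)$ has a finite filtration with factors of the form $\Delta(\mu)\otimes_R U_\mu$, where $\mu>\lambda$ and $U_\mu$ is a finitely generated projective $R$-module; (5) the $P(\lambda)$ in (4) can be chosen such that $\operatorname{add}_A\bigl(\bigoplus_{\lambda\in\Lambda}P(\lambda)\bigr)$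 is the class of all finitely generated projective $A$-modules. Suppose that $(A,\{\Delta(\lambda)\}_{\lambda\in\Lambda})$ is a split quasi-hereditary $R$-algebra. Then there is a family $\{\nabla(\lambda)\}_{\lambda\in\Lambda}$ of finitely generated left $A$-modules such that (i) $(A^{op},\{D\nabla(\lambda)\}_{\lambda\in\Lambda})$ is a split quasi-hereditary $R$-algebra (with the same poset $\Lambda$); (ii) for $\lambda,\beta\in\Lambda$ and $i\ge 0$, $\operatorname{Ext}^i_A(\Delta(\lambda),\nabla(\beta))\simeq R$ as $R$-modules if $i=0$ and $\lambda=\beta$, and $\operatorname{Ext}^i_A(\Delta(\lambda),\nabla(\beta))=0$ otherwise. Moreover, the family is unique up to isomorphism: if $\{\nabla'(\lambda)\}_{\lambda\in\Lambda}$ is any family of left $A$-modules satisfying (i) and (ii), then $\nabla'(\lambda)\simeq\nabla(\lambda)$ as $A$-modules for every $\lambda\in\Lambda$. (The modules $\nabla(\lambda)$ are called the costandard modules.) -/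

import Mathlib

open CategoryTheory
open scoped TensorProduct ModuleCat.Algebra

universe u w w'

namespace SplitQH

section General

variable (A : Type u) [Ring A]

/-- `N` belongs to the additive closure `add_A M`: it is a direct summand of a finite direct sum
of copies of `M`. -/
def InAdd (M : Type w) [AddCommGroup M] [Module A M]
    (N : Type w') [AddCommGroup N] [Module A N] : Prop :=
  ∃ (n : ℕ) (i : N →ₗ[A] (Fin n → M)) (p : (Fin n → M) →ₗ[A] N), p ∘ₗ i = LinearMap.id

/-- `M` belongs to `F(θ)`: it has a finite filtration `0 = F 0 ⊆ F 1 ⊆ ⋯ ⊆ F t = M` by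
submodules, each factor `F (i+1) / F i` being isomorphic to a module in `θ`. -/
def HasFiltration (θ : ModuleCat.{u} A → Prop) (M : Type u) [AddCommGroup M] [Module A M] :
    Prop :=
  ∃ (t : ℕ) (F : ℕ → Submodule A M), Monotone F ∧ F 0 = ⊥ ∧ F t = ⊤ ∧
    ∀ i < t, ∃ X : ModuleCat.{u} A, θ X ∧
      Nonempty ((F (i + 1) ⧸ (F i).submoduleOf (F (i + 1))) ≃ₗ[A] X)

end General

section Algebra

/-! Every object of `ModuleCat A` carries the `R`-module structure obtained by restriction along
`R → A` (the scoped instances of `ModuleCat.Algebra`). -/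

variable (R : Type u) [CommRing R] {A : Type u} [Ring A] [Algebra R A]

/-- The action of the opposite algebra on `Hom_R(M, R)`, given by `(f · a)(m) = f (a m)`. -/
@[reducible] def dualModuleStructure (M : ModuleCat.{u} A) : Module Aᵐᵒᵖ (M →ₗ[R] R) where
  smul a f := f ∘ₗ Module.toModuleEnd R (S := A) M a.unop
  one_smul f := by
    ext m; exact congrArg f (one_smul A m)
  mul_smul a b f := by
    ext m; exact congrArg f (mul_smul b.unop a.unop m)
  smul_zero a := by
    ext m; rfl
  smul_add a f g := by
    ext m; rfl
  add_smul a b f := by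
    ext m
    exact (congrArg f (add_smul a.unop b.unop m)).trans (map_add f _ _)
  zero_smul f := by
    ext m
    exact (congrArg f (zero_smul A m)).trans (map_zero f)

/-- The standard duality on objects: `D M = Hom_R(M, R)` as a module over `Aᵒᵖ`. -/
def dual (M : ModuleCat.{u} A) : ModuleCat.{u} Aᵐᵒᵖ :=
  letI := dualModuleStructure R M
  ModuleCat.of Aᵐᵒᵖ (M →ₗ[R] R)

variable {Λ : Type w} [PartialOrder Λ]

/-- `X` is isomorphic to `Δ(μ) ⊗_R U` for some `μ > l` and some finitely generated projective
`R`-module `U`. -/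
def IsStandardTensorAbove (Δ : Λ → ModuleCat.{u} A) (l : Λ) (X : ModuleCat.{u} A) : Prop :=
  ∃ μ : Λ, l < μ ∧ ∃ U : ModuleCat.{u} R, Module.Finite R U ∧ Module.Projective R U ∧
    Nonempty (X ≃ₗ[A] (Δ μ ⊗[R] U))

/-- `(A, {Δ(l)})` is a split quasi-hereditary `R`-algebra, for a projective Noetherian
`R`-algebra `A` and modules `Δ(l)` indexed by a poset `Λ`. -/
structure IsSplitQuasiHereditary (Δ : Λ → ModuleCat.{u} A) : Prop where
  noetherian : IsNoetherianRing R
  algebra_finite : Module.Finite R A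
  algebra_projective : Module.Projective R A
  finite : ∀ l, Module.Finite A (Δ l)
  projective : ∀ l, Module.Projective R (Δ l)
  le_of_hom_ne_zero : ∀ l μ, (∃ f : Δ l →ₗ[A] Δ μ, f ≠ 0) → l ≤ μ
  end_equiv : ∀ l, Nonempty (Module.End A (Δ l) ≃ₐ[R] R)
  exists_projectives : ∃ P : Λ → ModuleCat.{u} A,
    (∀ l, Module.Finite A (P l) ∧ Module.Projective A (P l) ∧
      ∃ π : P l →ₗ[A] Δ l, Function.Surjective π ∧
        HasFiltration A (IsStandardTensorAbove R Δ l) (LinearMap.ker π)) ∧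
    ∀ Q : ModuleCat.{u} A,
      InAdd A (DirectSum Λ fun l => P l) Q ↔ (Module.Finite A Q ∧ Module.Projective A Q)

/-- The modules `nabla(l)` have the two properties that characterise costandard modules:
`(Aᵒᵖ, {D nabla(l)})` is split quasi-hereditary, and `Ext_A^i(Δ(l), nabla(β))` is isomorphic to
`R` as an `R`-module if `i = 0` and `l = β`, and is zero otherwise. -/
structure IsCostandard (Δ nabla : Λ → ModuleCat.{u} A) : Prop where
  opposite : IsSplitQuasiHereditary R (fun l => dual R (nabla l))
  ext_equiv : ∀ l, Nonempty (Abelian.Ext (Δ l) (nabla l) 0 ≃ₗ[R] R)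
  ext_zero : ∀ (l β : Λ) (i : ℕ), ¬ (i = 0 ∧ l = β) →
    Subsingleton (Abelian.Ext (Δ l) (nabla β) i)

end Algebra

end SplitQH

/-! Number Λ (finite unless `R = 0`) so that larger elements come first. Successively factoring out
traces of the Δ(l) in this order gives every module a functorial chain of submodules, its tower. For
A itself the tower is a heredity chain of two-sided ideals J_0 ⊆ J_1 ⊆ ⋯, and Δ(l) is the quotient
of P(l) by its step k = rank(l) (`tower_P`). Since copies of Δ(l) can be moved to the bottom of a
filtration (`Filt.step`), E(l) = Hom_A(Δ(l), A/J_k) is finitely generated projective over R, and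
evaluation identifies Δ(l) ⊗_R E(l) with J_{k+1}/J_k.

The E(l) are the standard modules of the opposite algebra. The right module Hom_A(P(l), A) maps onto
E(l) with kernel Hom_A(P(l), J_k). The layers of this kernel are E(μ) ⊗_R Hom_A(P(l), Δ(μ)), and
they vanish unless μ > l. Put ∇(l) = D E(l); reflexivity over R gives D∇(l) ≅ E(l).

Dual bases of the P(l) compute Hom_A(Δ(l), ∇(β)). Ext¹ vanishes because a map C(l) → ∇(β) extends to
P(l): the only case with nonzero maps is l < β, where an R-linear retraction yields a bilinear form
that descends to E(β) because the heredity ideals are idempotent (`exists_extension_of_lt`,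
`tower_ring_le_span`). Higher Ext follows by dimension shifting.

For uniqueness, any Y with the orthogonality of ∇(l) has a natural map to D E(l). It is bijective on
Hom_A(Δ(μ), -), hence on Hom_A(P(μ), -) by a five-lemma argument using Ext¹(Δ(μ), Y) = 0, hence on
Hom_A(A, -). -/

namespace SplitQH

/-! ### Factorisations, direct summands and filtrations by standard modules -/

section Factor

variable {A : Type*} [Ring A] {M N Y : Type*} [AddCommGroup M] [Module A M] [AddCommGroup N]
  [Module A N] [AddCommGroup Y] [Module A Y]

lemma exists_lift_of_injective (j : M →ₗ[A] N) (hj : Function.Injective j) (f : Y →ₗ[A] N)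
    (hf : ∀ y, f y ∈ Set.range j) : ∃ k : Y →ₗ[A] M, j ∘ₗ k = f := by
  refine ⟨(LinearEquiv.ofInjective j hj).symm.toLinearMap ∘ₗ
    f.codRestrict (LinearMap.range j) hf, ?_⟩
  ext y
  exact congrArg Subtype.val
    ((LinearEquiv.ofInjective j hj).apply_symm_apply (f.codRestrict (LinearMap.range j) hf y))

lemma exists_desc_of_surjective (g : M →ₗ[A] N) (hg : Function.Surjective g) (f : M →ₗ[A] Y)
    (hf : ∀ y, g y = 0 → f y = 0) : ∃ k : N →ₗ[A] Y, k ∘ₗ g = f := by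
  refine ⟨(LinearMap.ker g).liftQ f hf ∘ₗ (g.quotKerEquivOfSurjective hg).symm.toLinearMap, ?_⟩
  ext y
  have : (g.quotKerEquivOfSurjective hg).symm (g y) = Submodule.Quotient.mk y := by
    rw [LinearEquiv.symm_apply_eq]; rfl
  simp only [LinearMap.comp_apply, LinearEquiv.coe_coe, this]
  exact Submodule.liftQ_apply _ _ _

end Factor

section SumRetract

variable (A : Type*) [Ring A]

/-- The identity of `N` is a finite sum of maps factoring through `X`; equivalently, `N` is a
direct summand of a finite direct sum of copies of `X`. -/
def IsSumRetract (X N : Type*) [AddCommGroup X] [Module A X] [AddCommGroup N] [Module A N] :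
    Prop :=
  ∃ (m : ℕ) (i : Fin m → N →ₗ[A] X) (p : Fin m → X →ₗ[A] N), ∀ y, ∑ s, p s (i s y) = y

variable {A}
variable {X N N' Y : Type*} [AddCommGroup X] [Module A X] [AddCommGroup N] [Module A N]
  [AddCommGroup N'] [Module A N'] [AddCommGroup Y] [Module A Y]

lemma IsSumRetract.of_retract (h : IsSumRetract A X N) (i : N' →ₗ[A] N) (p : N →ₗ[A] N')
    (hp : ∀ y, p (i y) = y) : IsSumRetract A X N' := by
  obtain ⟨m, j, q, hjq⟩ := h
  refine ⟨m, fun s => j s ∘ₗ i, fun s => p ∘ₗ q s, fun y => ?_⟩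
  simp only [LinearMap.comp_apply, ← map_sum, hjq, hp]

lemma IsSumRetract.pi (m : ℕ) : IsSumRetract A X (Fin m → X) :=
  ⟨m, fun s => LinearMap.proj s, fun s => LinearMap.single A (fun _ => X) s, fun y => by
    funext t
    simp [Finset.sum_apply, Pi.single_apply]⟩

lemma IsSumRetract.of_inAdd (h : InAdd A X N) : IsSumRetract A X N := by
  obtain ⟨m, i, p, hp⟩ := h
  exact (IsSumRetract.pi m).of_retract i p (LinearMap.congr_fun hp)

lemma IsSumRetract.inAdd (h : IsSumRetract A X N) : InAdd A X N := by
  obtain ⟨m, i, p, hp⟩ := h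
  refine ⟨m, LinearMap.pi i, ∑ s, p s ∘ₗ LinearMap.proj s, ?_⟩
  ext y
  simpa using hp y

/-- A finitely generated projective module has a finite dual basis. -/
lemma IsSumRetract.of_projective [Module.Finite A N] [Module.Projective A N] :
    IsSumRetract A A N := by
  obtain ⟨m, f, g, -, -, h⟩ := Module.Finite.exists_comp_eq_id_of_projective A N
  exact (IsSumRetract.pi m).of_retract g f (LinearMap.congr_fun h)

lemma IsSumRetract.projective (h : IsSumRetract A X N) [Module.Projective A X] :
    Module.Projective A N := by
  obtain ⟨m, i, p, hp⟩ := h.inAdd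
  have := Module.Projective.of_equiv (DFinsupp.linearEquivFunOnFintype (R := A) (M := fun _ : Fin m => X))
  exact Module.Projective.of_split i p hp

lemma IsSumRetract.finite (h : IsSumRetract A X N) [Module.Finite A X] :
    Module.Finite A N := by
  obtain ⟨m, i, p, hp⟩ := h.inAdd
  exact Module.Finite.of_surjective p fun y => ⟨i y, LinearMap.congr_fun hp y⟩

lemma IsSumRetract.hom_eq_zero_left (h : IsSumRetract A X N) (h0 : ∀ f : X →ₗ[A] Y, f = 0)
    (f : N →ₗ[A] Y) : f = 0 := by
  obtain ⟨m, i, p, hp⟩ := h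
  ext y
  rw [← hp y, map_sum]
  exact Finset.sum_eq_zero fun s _ => LinearMap.congr_fun (h0 (f ∘ₗ p s)) (i s y)

lemma IsSumRetract.hom_eq_zero_right (h : IsSumRetract A X N) (h0 : ∀ f : Y →ₗ[A] X, f = 0)
    (f : Y →ₗ[A] N) : f = 0 := by
  obtain ⟨m, i, p, hp⟩ := h
  ext y
  rw [← hp (f y)]
  refine Finset.sum_eq_zero fun s _ => ?_
  rw [show i s (f y) = 0 from LinearMap.congr_fun (h0 (i s ∘ₗ f)) y, map_zero]

end SumRetract

section Tensor

variable {R A : Type*} [CommRing R] [Ring A] [Algebra R A]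
variable {D U : Type*} [AddCommGroup D] [Module R D] [Module A D] [IsScalarTower R A D]
  [AddCommGroup U] [Module R U]

-- A dual basis of U exhibits D ⊗ U as a summand of a finite power of D. Filtration factors Δ(μ) ⊗ U
-- may therefore be treated as summands of powers of Δ(μ), with no further mention of U.
variable (R A) in
lemma IsSumRetract.tensor [Module.Finite R U] [Module.Projective R U] :
    IsSumRetract A D (D ⊗[R] U) := by
  obtain ⟨m, i, p, hp⟩ := IsSumRetract.of_projective (A := R) (N := U)
  refine ⟨m, fun s => (TensorProduct.AlgebraTensorModule.rid R A D).toLinearMap ∘ₗ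
      TensorProduct.AlgebraTensorModule.map LinearMap.id (i s),
    fun s => TensorProduct.AlgebraTensorModule.map LinearMap.id (p s) ∘ₗ
      (TensorProduct.AlgebraTensorModule.rid R A D).symm.toLinearMap, fun y => ?_⟩
  simp only [LinearMap.comp_apply, LinearEquiv.coe_coe, LinearEquiv.symm_apply_apply]
  induction y with
  | zero => simp
  | add y z hy hz => simp only [map_add, Finset.sum_add_distrib, hy, hz]
  | tmul d v =>
    simp only [TensorProduct.AlgebraTensorModule.map_tmul, LinearMap.id_apply,
      ← TensorProduct.tmul_sum, hp]

end Tensor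

section Filt

variable {A : Type u} [Ring A] {Λ : Type w} (Δ : Λ → ModuleCat.{u} A)

/-- `M` has a finite filtration whose factors are direct summands of finite direct sums of copies
of modules `Δ μ` with `μ ∈ S`. -/
inductive Filt (S : Set Λ) : ∀ (M : Type u) [AddCommGroup M] [Module A M], Prop
  | zero (M : Type u) [AddCommGroup M] [Module A M] (h : Subsingleton M) : Filt S M
  | ext {M' M M'' : Type u} [AddCommGroup M'] [Module A M'] [AddCommGroup M] [Module A M]
      [AddCommGroup M''] [Module A M''] (f : M' →ₗ[A] M) (g : M →ₗ[A] M'')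
      (hf : Function.Injective f) (hg : Function.Surjective g) (hfg : Function.Exact f g)
      (μ : Λ) (hμ : μ ∈ S) (h'' : IsSumRetract A (Δ μ) M'') (h' : Filt S M') : Filt S M

variable {Δ}

lemma Filt.of_equiv {S : Set Λ} {M N : Type u} [AddCommGroup M] [Module A M] [AddCommGroup N]
    [Module A N] (e : M ≃ₗ[A] N) (h : Filt Δ S M) : Filt Δ S N := by
  cases h with
  | zero _ h => exact .zero _ e.symm.injective.subsingleton
  | ext f g hf hg hfg μ hμ h'' h' =>
    refine .ext (e.toLinearMap ∘ₗ f) (g ∘ₗ e.symm.toLinearMap) (e.injective.comp hf)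
      (hg.comp e.symm.surjective) (fun y => ?_) μ hμ h'' h'
    have := hfg (e.symm y)
    simp only [LinearMap.comp_apply, LinearEquiv.coe_coe, this, Set.mem_range,
      LinearEquiv.eq_symm_apply]

lemma Filt.mono {S S' : Set Λ} (hS : S ⊆ S') {M : Type u} [AddCommGroup M] [Module A M]
    (h : Filt Δ S M) : Filt Δ S' M := by
  induction h with
  | zero M h => exact .zero _ h
  | ext f g hf hg hfg μ hμ h'' h' ih => exact .ext f g hf hg hfg μ (hS hμ) h'' ih

lemma Filt.subsingleton {M : Type u} [AddCommGroup M] [Module A M]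
    (h : Filt Δ ∅ M) : Subsingleton M := by
  cases h with
  | zero _ h => exact h
  | ext f g hf hg hfg μ hμ h'' h' => exact absurd hμ (by simp)

lemma Filt.hom_eq_zero_right {S : Set Λ} {Y M : Type u} [AddCommGroup Y] [Module A Y]
    [AddCommGroup M] [Module A M] (h : Filt Δ S M)
    (h0 : ∀ μ ∈ S, ∀ f : Y →ₗ[A] Δ μ, f = 0) (f : Y →ₗ[A] M) : f = 0 := by
  induction h with
  | zero M h => exact Subsingleton.elim _ _
  | ext j g hj hg hfg μ hμ h'' h' ih =>
    have hgf : ∀ y, g (f y) = 0 := LinearMap.congr_fun (h''.hom_eq_zero_right (h0 μ hμ) (g ∘ₗ f))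
    obtain ⟨k, rfl⟩ := exists_lift_of_injective j hj f fun y => (hfg _).1 (hgf y)
    rw [ih k, LinearMap.comp_zero]

lemma Filt.hom_eq_zero_left {S : Set Λ} {Y M : Type u} [AddCommGroup Y] [Module A Y]
    [AddCommGroup M] [Module A M] (h : Filt Δ S M)
    (h0 : ∀ μ ∈ S, ∀ f : Δ μ →ₗ[A] Y, f = 0) (f : M →ₗ[A] Y) : f = 0 := by
  induction h with
  | zero M h => ext y; rw [Subsingleton.elim y 0]; simp
  | ext j g hj hg hfg μ hμ h'' h' ih =>
    obtain ⟨k, rfl⟩ := exists_desc_of_surjective g hg f fun y hy => by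
      obtain ⟨z, rfl⟩ := (hfg y).1 hy
      exact LinearMap.congr_fun (ih (f ∘ₗ j)) z
    rw [h''.hom_eq_zero_left (h0 μ hμ) k, LinearMap.zero_comp]

end Filt

section FromHasFiltration

variable {R : Type u} [CommRing R] {A : Type u} [Ring A] [Algebra R A]
  {Λ : Type w} [PartialOrder Λ] {Δ : Λ → ModuleCat.{u} A}

lemma HasFiltration.filt {l : Λ} {M : Type u} [AddCommGroup M] [Module A M]
    (h : HasFiltration A (IsStandardTensorAbove R Δ l) M) : Filt Δ (Set.Ioi l) M := by
  obtain ⟨t, F, hF, h0, ht, hX⟩ := h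
  have key : ∀ i ≤ t, Filt Δ (Set.Ioi l) (F i) := by
    intro i
    induction i with
    | zero => intro _; exact .zero _ (by rw [h0]; infer_instance)
    | succ i ih =>
      intro hi
      obtain ⟨X, ⟨μ, hμ, U, hU, hU', ⟨e⟩⟩, ⟨e'⟩⟩ := hX i (by omega)
      have hle : F i ≤ F (i + 1) := hF (Nat.le_succ i)
      refine .ext (Submodule.inclusion hle) (Submodule.mkQ _) (Submodule.inclusion_injective _)
        (Submodule.mkQ_surjective _) (fun y => ?_) μ hμ ((IsSumRetract.tensor R A
          (D := Δ μ) (U := U)).of_retract (e' ≪≫ₗ e).toLinearMap (e' ≪≫ₗ e).symm.toLinearMap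
          (fun y => by simp)) (ih (by omega))
      rw [Submodule.mkQ_apply, Submodule.Quotient.mk_eq_zero, Submodule.submoduleOf, Submodule.mem_comap]
      simp only [Set.mem_range, Subtype.ext_iff, Submodule.coe_inclusion]
      exact ⟨fun h => ⟨⟨_, h⟩, rfl⟩, fun ⟨z, hz⟩ => by
        rw [Submodule.subtype_apply, ← hz]; exact z.2⟩
  have := key t le_rfl
  rw [ht] at this
  exact this.of_equiv Submodule.topEquiv

end FromHasFiltration

end SplitQH

namespace SplitQH

/-! ### Traces and evaluation maps -/

section Trace

variable {A : Type*} [Ring A]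
variable (D M : Type*) {N : Type*} [AddCommGroup D] [Module A D] [AddCommGroup M] [Module A M]
  [AddCommGroup N] [Module A N]

variable (A) in
/-- The trace of `D` in `M`. -/
def trace : Submodule A M := ⨆ f : D →ₗ[A] M, LinearMap.range f

variable {D M}

lemma mem_trace (f : D →ₗ[A] M) (x : D) : f x ∈ trace A D M :=
  Submodule.mem_iSup_of_mem f ⟨x, rfl⟩

lemma trace_le {S : Submodule A M} (h : ∀ (f : D →ₗ[A] M) (x : D), f x ∈ S) : trace A D M ≤ S :=
  iSup_le fun f => by rintro _ ⟨x, rfl⟩; exact h f x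

lemma trace_le_comap (g : M →ₗ[A] N) : trace A D M ≤ (trace A D N).comap g :=
  trace_le fun f x => mem_trace (g ∘ₗ f) x

end Trace

section Ev

variable {R A : Type*} [CommRing R] [Ring A] [Algebra R A]
variable (D : Type*) [AddCommGroup D] [Module A D]
variable {M N : Type*} [AddCommGroup M] [Module R M] [Module A M] [IsScalarTower R A M]
  [AddCommGroup N] [Module R N] [Module A N] [IsScalarTower R A N]

variable (R) in
/-- Composition with an `A`-linear map, as an `R`-linear map. -/
def homMap (f : M →ₗ[A] N) : (D →ₗ[A] M) →ₗ[R] (D →ₗ[A] N) where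
  toFun h := f ∘ₗ h
  map_add' h h' := LinearMap.comp_add _ _ _
  map_smul' r h := by ext x; exact LinearMap.map_smul_of_tower f r (h x)

@[simp] lemma homMap_apply (f : M →ₗ[A] N) (h : D →ₗ[A] M) : homMap R D f h = f ∘ₗ h := rfl

variable {ι : Type*} [Fintype ι] {X : ι → Type*} [∀ s, AddCommGroup (X s)] [∀ s, Module R (X s)]
  [∀ s, Module A (X s)] [∀ s, IsScalarTower R A (X s)]

variable {D} in
lemma hom_projective_of_sum (i : ∀ s, N →ₗ[A] X s) (p : ∀ s, X s →ₗ[A] N)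
    (hp : ∀ y, ∑ s, p s (i s y) = y)
    (hf : ∀ s, Module.Finite R (D →ₗ[A] X s)) (h : ∀ s, Module.Projective R (D →ₗ[A] X s)) :
    Module.Finite R (D →ₗ[A] N) ∧ Module.Projective R (D →ₗ[A] N) := by
  classical
  have := Module.Projective.of_equiv
    (DFinsupp.linearEquivFunOnFintype (R := R) (M := fun s => D →ₗ[A] X s))
  let I : (D →ₗ[A] N) →ₗ[R] (∀ s, D →ₗ[A] X s) := LinearMap.pi fun s => homMap R D (i s)
  let P : (∀ s, D →ₗ[A] X s) →ₗ[R] (D →ₗ[A] N) := ∑ s, homMap R D (p s) ∘ₗ LinearMap.proj s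
  have hPI : P ∘ₗ I = LinearMap.id := by
    ext h y
    simpa [I, P] using hp (h y)
  exact ⟨Module.Finite.of_surjective P fun y => ⟨I y, LinearMap.congr_fun hPI y⟩,
    Module.Projective.of_split I P hPI⟩

variable [Module R D] [IsScalarTower R A D]

variable (R A M) in
/-- The evaluation map `D ⊗ Hom_A(D, M) → M`. -/
def ev : D ⊗[R] (D →ₗ[A] M) →ₗ[A] M :=
  TensorProduct.AlgebraTensorModule.lift
    { toFun := fun d =>
        { toFun := fun h => h d
          map_add' := fun _ _ => rfl
          map_smul' := fun _ _ => rfl }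
      map_add' := fun d d' => by ext h; exact map_add h d d'
      map_smul' := fun a d => by ext h; exact map_smul h a d }

variable {D}

@[simp] lemma ev_tmul (d : D) (h : D →ₗ[A] M) : ev R A D M (d ⊗ₜ h) = h d := rfl

lemma ev_lTensor (f : M →ₗ[A] N) (z : D ⊗[R] (D →ₗ[A] M)) :
    ev R A D N ((homMap R D f).lTensor D z) = f (ev R A D M z) := by
  induction z with
  | zero => simp
  | add y z hy hz => simp only [map_add, hy, hz]
  | tmul d h => simp

variable (D) in
lemma ev_injective_of_subsingleton [Subsingleton (D →ₗ[A] M)] :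
    Function.Injective (ev R A D M) := by
  have h0 : ∀ z : D ⊗[R] (D →ₗ[A] M), z = 0 := fun z => by
    induction z with
    | zero => rfl
    | add y z hy hz => rw [hy, hz, add_zero]
    | tmul d h => rw [Subsingleton.elim h 0, TensorProduct.tmul_zero]
  intro y z _
  rw [h0 y, h0 z]

variable (R A) in
lemma range_ev : LinearMap.range (ev R A D M) = trace A D M := by
  apply le_antisymm
  · rintro _ ⟨z, rfl⟩
    induction z with
    | zero => simp
    | add y z hy hz => rw [map_add]; exact add_mem hy hz
    | tmul d h => exact mem_trace h d
  · exact trace_le fun f x => ⟨x ⊗ₜ f, rfl⟩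

lemma ev_injective_of_sum (i : ∀ s, N →ₗ[A] X s) (p : ∀ s, X s →ₗ[A] N)
    (hp : ∀ y, ∑ s, p s (i s y) = y) (h : ∀ s, Function.Injective (ev R A D (X s))) :
    Function.Injective (ev R A D N) := by
  rw [injective_iff_map_eq_zero]
  intro z hz
  have hsum : ∀ z, ∑ s, (homMap R D (p s)).lTensor D ((homMap R D (i s)).lTensor D z) = z := by
    intro z
    induction z with
    | zero => simp
    | add y z hy hz => simp only [map_add, Finset.sum_add_distrib, hy, hz]
    | tmul d h =>
      simp only [LinearMap.lTensor_tmul, ← TensorProduct.tmul_sum]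
      congr 1
      ext y
      simpa using hp (h y)
  rw [← hsum z]
  refine Finset.sum_eq_zero fun s _ => ?_
  have : (homMap R D (i s)).lTensor D z = 0 := h s (by rw [ev_lTensor, hz, map_zero, map_zero])
  rw [this, map_zero]

/-- The evaluation map of `D` at itself, when all endomorphisms of `D` are scalars. -/
lemma ev_self_injective (hD : Function.Bijective (algebraMap R (Module.End A D))) :
    Function.Injective (ev R A D D) := by
  -- Endomorphisms are scalars, so every tensor is pure with second factor the identity and is
  -- recovered from its value under `ev`.
  have key : ∀ z : D ⊗[R] (D →ₗ[A] D), z = ev R A D D z ⊗ₜ LinearMap.id := by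
    intro z
    induction z with
    | zero => simp
    | add y z hy hz => rw [map_add, TensorProduct.add_tmul, ← hy, ← hz]
    | tmul d h =>
      obtain ⟨r, rfl⟩ := hD.2 h
      rw [ev_tmul]
      exact (TensorProduct.tmul_smul r d (LinearMap.id : D →ₗ[A] D)).trans
        (TensorProduct.smul_tmul' r d _)
  intro y z hyz
  rw [key y, key z, hyz]

lemma hom_self_projective (hD : Function.Bijective (algebraMap R (Module.End A D))) :
    Module.Finite R (D →ₗ[A] D) ∧ Module.Projective R (D →ₗ[A] D) := by
  let e : R ≃ₗ[R] Module.End A D := LinearEquiv.ofBijective (Algebra.linearMap R _) hD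
  exact ⟨Module.Finite.equiv e, Module.Projective.of_equiv e⟩

end Ev

/-! ### Moving the copies of one standard module to the bottom of a filtration -/

section Step

variable {R : Type u} [CommRing R] {A : Type u} [Ring A] [Algebra R A]
  {Λ : Type w} [PartialOrder Λ] {Δ : Λ → ModuleCat.{u} A}

/-- Splitting off all the copies of `Δ l` at the bottom of a filtered module. -/
theorem Filt.step {S : Set Λ} {l : Λ}
    (hend : Function.Bijective (algebraMap R (Module.End A (Δ l))))
    (hom : ∀ l μ, (∃ f : Δ l →ₗ[A] Δ μ, f ≠ 0) → l ≤ μ)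
    {P : Type u} [AddCommGroup P] [Module A P] [Module.Projective A P] (π : P →ₗ[A] Δ l)
    (hπ : Function.Surjective π) (hC : Filt Δ (Set.Ioi l) (LinearMap.ker π))
    (hS : ∀ μ ∈ S, ¬ l < μ) {M : Type u} [AddCommGroup M] [Module A M] (h : Filt Δ S M) :
    ∀ [Module R M] [IsScalarTower R A M], (Module.Finite R (Δ l →ₗ[A] M) ∧ Module.Projective R (Δ l →ₗ[A] M)) ∧
      Function.Injective (ev R A (Δ l) M) ∧ Filt Δ (S \ {l}) (M ⧸ trace A (Δ l) M) := by
  have hom' : ∀ {l μ} (f : Δ l →ₗ[A] Δ μ), ¬ l ≤ μ → f = 0 := fun f hf => by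
    by_contra h
    exact hf (hom _ _ ⟨f, h⟩)
  induction h with
  | zero M h =>
    intro _ _
    have : Subsingleton (Δ l →ₗ[A] M) := ⟨fun f g => by ext; exact Subsingleton.elim _ _⟩
    exact ⟨⟨inferInstance, inferInstance⟩, ev_injective_of_subsingleton _,
      .zero _ (Submodule.Quotient.mk_surjective _).subsingleton⟩
  | @ext M' M M'' _ _ _ _ _ _ f g hf hg hfg μ hμ h'' h' ih =>
    intro _ _
    let _ : Module R M' := Module.compHom M' (algebraMap R A)
    have : IsScalarTower R A M' := ⟨fun r a x => by
      rw [Algebra.smul_def, mul_smul]; rfl⟩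
    let _ : Module R M'' := Module.compHom M'' (algebraMap R A)
    have : IsScalarTower R A M'' := ⟨fun r a x => by
      rw [Algebra.smul_def, mul_smul]; rfl⟩
    obtain ⟨⟨ih1, ih2⟩, ih3, ih4⟩ := ih
    -- every map from `Δ l` to `M''` lifts to `M`
    have hlift : Function.Surjective (homMap R (Δ l) g) := by
      intro k
      obtain ⟨q, hq⟩ := Module.projective_lifting_property g (k ∘ₗ π) hg
      have hq' : ∀ y, g (q y) = k (π y) := LinearMap.congr_fun hq
      -- On the kernel of `π`, the map `q` lands in `M'`. Factors of the kernel have index ν > l and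
      -- those of `M'` have index κ with `¬ l < κ`; a nonzero map Δ(ν) → Δ(κ) would force l < ν ≤ κ.
      have hz : q ∘ₗ (LinearMap.ker π).subtype = 0 := by
        obtain ⟨j, hj⟩ := exists_lift_of_injective f hf (q ∘ₗ (LinearMap.ker π).subtype)
          fun y => (hfg _).1 (by
            have := hq' y
            rw [show π y = 0 from y.2, map_zero] at this
            exact this)
        rw [← hj, hC.hom_eq_zero_left (fun ν hν k => h'.hom_eq_zero_right (fun κ hκ k =>
          hom' k fun hle => hS κ hκ (lt_of_lt_of_le hν hle)) k) j, LinearMap.comp_zero]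
      obtain ⟨k', rfl⟩ := exists_desc_of_surjective π hπ q fun y hy =>
        LinearMap.congr_fun hz ⟨y, hy⟩
      refine ⟨k', ?_⟩
      ext y
      obtain ⟨y, rfl⟩ := hπ y
      exact hq' y
    have hexact : Function.Exact (homMap R (Δ l) f) (homMap R (Δ l) g) := by
      intro k
      constructor
      · intro hk
        exact exists_lift_of_injective f hf k fun y => (hfg _).1 (LinearMap.congr_fun hk y)
      · rintro ⟨k, rfl⟩
        ext y
        exact (hfg _).2 ⟨k y, rfl⟩
    have hinj : Function.Injective (homMap R (Δ l) f) := fun k k' hk => by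
      ext y
      exact hf (LinearMap.congr_fun hk y)
    have hN : (Module.Finite R (Δ l →ₗ[A] M'') ∧ Module.Projective R (Δ l →ₗ[A] M'')) ∧
        Function.Injective (ev R A (Δ l) M'') := by
      by_cases hl : μ = l
      · subst hl
        obtain ⟨m, i, p, hp⟩ := h''
        exact ⟨hom_projective_of_sum i p hp
          (fun _ => (hom_self_projective hend).1) (fun _ => (hom_self_projective hend).2),
          ev_injective_of_sum i p hp fun _ => ev_self_injective hend⟩
      · have h0 : ∀ k : Δ l →ₗ[A] M'', k = 0 := h''.hom_eq_zero_right fun k =>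
          hom' k fun hle => hS μ hμ (lt_of_le_of_ne hle (Ne.symm hl))
        have : Subsingleton (Δ l →ₗ[A] M'') := ⟨fun f g => by rw [h0 f, h0 g]⟩
        exact ⟨⟨inferInstance, inferInstance⟩, ev_injective_of_subsingleton _⟩
    obtain ⟨⟨hN1, hN2⟩, hN3⟩ := hN
    have htens := lTensor_exact (Δ l) hexact hlift
    -- Right exactness of the tensor product and injectivity of `ev` on `M''` push `z` back to `M'`.
    -- Injectivity of `ev` on `M` and of the map between trace quotients both rest on this.
    have hchase : ∀ z, g (ev R A (Δ l) M z) = 0 →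
        ∃ z', (homMap R (Δ l) f).lTensor (Δ l) z' = z := fun z hz =>
      (htens z).1 (hN3 (by rw [ev_lTensor, hz, map_zero]))
    refine ⟨⟨Module.Finite.of_exact hexact hlift, ?_⟩, ?_, ?_⟩
    -- Projectivity of Hom(Δ(l), M'') splits the exact sequence of Hom modules.
    · obtain ⟨s, hs⟩ := Module.projective_lifting_property (homMap R (Δ l) g) LinearMap.id hlift
      have hs' : ∀ y, homMap R (Δ l) g (s y) = y := LinearMap.congr_fun hs
      refine Module.Projective.of_equiv (LinearEquiv.ofBijective
        ((homMap R (Δ l) f).coprod s) ⟨?_, fun y => ?_⟩)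
      · rw [injective_iff_map_eq_zero]
        rintro ⟨a, b⟩ hab
        have hab' : homMap R (Δ l) f a + s b = 0 := hab
        have hb : b = 0 := by
          have := congrArg (homMap R (Δ l) g) hab'
          rwa [map_add, hs', map_zero, (hexact _).2 ⟨a, rfl⟩, zero_add] at this
        subst hb
        rw [map_zero, add_zero] at hab'
        rw [hinj (hab'.trans (map_zero _).symm)]
        rfl
      · obtain ⟨a, ha⟩ := (hexact (y - s (homMap R (Δ l) g y))).1 (by
          rw [map_sub, hs', sub_self])
        exact ⟨(a, homMap R (Δ l) g y), by
          rw [LinearMap.coprod_apply, ha, sub_add_cancel]⟩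
    · rw [injective_iff_map_eq_zero]
      intro z hz
      obtain ⟨z', rfl⟩ := hchase z (by rw [hz, map_zero])
      rw [ev_lTensor] at hz
      rw [ih3 ((hf (hz.trans (map_zero f).symm)).trans (map_zero _).symm), map_zero]
    · let f' := (trace A (Δ l) M').mapQ (trace A (Δ l) M) f (trace_le_comap f)
      have hf' : Function.Injective f' := by
        rw [injective_iff_map_eq_zero]
        intro y hy
        obtain ⟨y, rfl⟩ := Submodule.Quotient.mk_surjective _ y
        rw [Submodule.mapQ_apply, Submodule.Quotient.mk_eq_zero, ← range_ev R A] at hy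
        obtain ⟨z, hz⟩ := hy
        obtain ⟨z', rfl⟩ := hchase z (by rw [hz]; exact (hfg _).2 ⟨y, rfl⟩)
        rw [ev_lTensor] at hz
        rw [Submodule.Quotient.mk_eq_zero, ← range_ev R A]
        exact ⟨z', hf hz⟩
      by_cases hl : μ = l
      · subst hl
        -- For μ = l the top factor `M''` equals its own trace, and maps from Δ(l) into it lift to
        -- `M`. It thus disappears from the quotient, leaving that of `M'`.
        refine Filt.of_equiv (LinearEquiv.ofBijective f' ⟨hf', fun y => ?_⟩) ih4
        obtain ⟨y, rfl⟩ := Submodule.Quotient.mk_surjective _ y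
        have hr : g y ∈ LinearMap.range (ev R A (Δ μ) M'') := by
          rw [range_ev R A]
          obtain ⟨m, i, p, hp⟩ := h''
          rw [← hp (g y)]
          exact sum_mem fun s _ => mem_trace (p s) _
        obtain ⟨z'', hz''⟩ := hr
        obtain ⟨z, rfl⟩ := LinearMap.lTensor_surjective (Δ μ) hlift z''
        rw [ev_lTensor] at hz''
        obtain ⟨x, hx⟩ := (hfg (y - ev R A (Δ μ) M z)).1 (by rw [map_sub, hz'', sub_self])
        refine ⟨Submodule.Quotient.mk x, ?_⟩
        rw [Submodule.mapQ_apply, hx, Submodule.Quotient.mk_sub, sub_eq_self,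
          Submodule.Quotient.mk_eq_zero, ← range_ev R A]
        exact ⟨z, rfl⟩
      · have h0 : ∀ k : Δ l →ₗ[A] M'', k = 0 := h''.hom_eq_zero_right fun k =>
          hom' k fun hle => hS μ hμ (lt_of_le_of_ne hle (Ne.symm hl))
        let g' := (trace A (Δ l) M).liftQ g (trace_le fun k x => LinearMap.congr_fun (h0 (g ∘ₗ k)) x)
        refine .ext f' g' hf' (fun y => ?_) (fun y => ?_) μ ⟨hμ, hl⟩ h'' ih4
        · obtain ⟨x, rfl⟩ := hg y
          exact ⟨Submodule.Quotient.mk x, Submodule.liftQ_apply _ _ _⟩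
        · obtain ⟨y, rfl⟩ := Submodule.Quotient.mk_surjective _ y
          constructor
          · intro hy
            obtain ⟨x, rfl⟩ := (hfg y).1 hy
            exact ⟨Submodule.Quotient.mk x, Submodule.mapQ_apply _ _ _ _⟩
          · rintro ⟨x, hx⟩
            obtain ⟨x, rfl⟩ := Submodule.Quotient.mk_surjective _ x
            rw [← hx]
            exact (hfg _).2 ⟨x, rfl⟩

end Step

end SplitQH

namespace SplitQH

/-! ### The tower of iterated traces -/

section Tower

variable {A : Type u} [Ring A] {Λ : Type w} (Δ : Λ → ModuleCat.{u} A) (σ : Λ → ℕ)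
variable (M : Type u) {N N' : Type u} [AddCommGroup M] [Module A M] [AddCommGroup N] [Module A N]
  [AddCommGroup N'] [Module A N']

/-- The submodules of `M` obtained by successively adding the traces of the `Δ l`, in the order
given by `σ`. -/
def tower : ℕ → Submodule A M
  | 0 => ⊥
  | k + 1 => (⨆ l, ⨆ (_ : σ l = k), trace A (Δ l) (M ⧸ tower k)).comap (tower k).mkQ

/-- The quotient of `M` by the `k`-th step of the tower. -/
def TowerQuot (k : ℕ) : Type u := M ⧸ tower Δ σ M k

namespace TowerQuot

instance (k : ℕ) : AddCommGroup (TowerQuot Δ σ M k) :=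
  inferInstanceAs (AddCommGroup (M ⧸ tower Δ σ M k))

instance (k : ℕ) : Module A (TowerQuot Δ σ M k) :=
  inferInstanceAs (Module A (M ⧸ tower Δ σ M k))

instance {R : Type*} [CommRing R] [Algebra R A] [Module R M] [IsScalarTower R A M] (k : ℕ) :
    Module R (TowerQuot Δ σ M k) :=
  inferInstanceAs (Module R (M ⧸ tower Δ σ M k))

instance {R : Type*} [CommRing R] [Algebra R A] [Module R M] [IsScalarTower R A M] (k : ℕ) :
    IsScalarTower R A (TowerQuot Δ σ M k) :=
  inferInstanceAs (IsScalarTower R A (M ⧸ tower Δ σ M k))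

/-- The projection of `M` onto its quotient. -/
def mk (k : ℕ) : M →ₗ[A] TowerQuot Δ σ M k := (tower Δ σ M k).mkQ

variable {M}

lemma mk_surjective (k : ℕ) : Function.Surjective (mk Δ σ M k) := Submodule.mkQ_surjective _

lemma mk_eq_zero {k : ℕ} {x : M} : mk Δ σ M k x = 0 ↔ x ∈ tower Δ σ M k :=
  Submodule.Quotient.mk_eq_zero _

end TowerQuot

variable {Δ σ M}

/-- Functoriality is inherited from traces. Applied to right multiplications of A, it makes the
steps of the tower of A two-sided ideals. -/
lemma tower_le_comap (f : M →ₗ[A] N) (k : ℕ) :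
    tower Δ σ M k ≤ (tower Δ σ N k).comap f := by
  induction k with
  | zero => exact bot_le
  | succ k ih =>
    intro x hx
    have hle : (⨆ l, ⨆ (_ : σ l = k), trace A (Δ l) (M ⧸ tower Δ σ M k)) ≤
        (⨆ l, ⨆ (_ : σ l = k), trace A (Δ l) (N ⧸ tower Δ σ N k)).comap
          (Submodule.mapQ _ _ f ih) :=
      iSup_le fun l => iSup_le fun hl => (trace_le_comap _).trans
        (Submodule.comap_mono (le_iSup₂_of_le l hl le_rfl))
    exact hle hx

lemma map_mem_tower (f : M →ₗ[A] N) {k : ℕ} {x : M} (hx : x ∈ tower Δ σ M k) :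
    f x ∈ tower Δ σ N k := tower_le_comap f k hx

namespace TowerQuot

/-- The map of quotients induced by an `A`-linear map. -/
def map (f : M →ₗ[A] N) (k : ℕ) : TowerQuot Δ σ M k →ₗ[A] TowerQuot Δ σ N k :=
  Submodule.mapQ _ _ f (tower_le_comap f k)

@[simp] lemma map_mk (f : M →ₗ[A] N) (k : ℕ) (x : M) :
    map f k (mk Δ σ M k x) = mk Δ σ N k (f x) := rfl

lemma map_map (g : N →ₗ[A] N') (f : M →ₗ[A] N) (k : ℕ) (x : TowerQuot Δ σ M k) :
    map g k (map f k x) = map (g ∘ₗ f) k x := by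
  obtain ⟨x, rfl⟩ := mk_surjective Δ σ k x
  rfl

end TowerQuot

lemma tower_succ (hσ : Function.Injective σ) (l : Λ) :
    tower Δ σ M (σ l + 1) =
      (trace A (Δ l) (TowerQuot Δ σ M (σ l))).comap (TowerQuot.mk Δ σ M (σ l)) := by
  have : (⨆ l', ⨆ (_ : σ l' = σ l), trace A (Δ l') (M ⧸ tower Δ σ M (σ l))) =
      trace A (Δ l) (M ⧸ tower Δ σ M (σ l)) := by
    apply le_antisymm
    · exact iSup₂_le fun l' hl' => by rw [hσ hl']
    · exact le_iSup₂_of_le l rfl le_rfl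
  rw [tower, this]
  rfl

lemma tower_succ_of_forall_ne {k : ℕ} (h : ∀ l, σ l ≠ k) :
    tower Δ σ M (k + 1) = tower Δ σ M k := by
  have : (⨆ l, ⨆ (_ : σ l = k), trace A (Δ l) (M ⧸ tower Δ σ M k)) = ⊥ :=
    le_bot_iff.1 (iSup₂_le fun l hl => absurd hl (h l))
  rw [tower, this, Submodule.comap_bot, Submodule.ker_mkQ]

lemma tower_mono : Monotone (tower Δ σ M) :=
  monotone_nat_of_le_succ fun k x hx => by
    rw [tower, Submodule.mem_comap, Submodule.mkQ_apply,
      (Submodule.Quotient.mk_eq_zero _).2 hx]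
    exact zero_mem _

lemma tower_eq_bot {k : ℕ} (h : ∀ l, σ l < k → ∀ f : Δ l →ₗ[A] M, f = 0) :
    tower Δ σ M k = ⊥ := by
  induction k with
  | zero => rfl
  | succ k ih =>
    have hb := ih fun l hl => h l (by omega)
    have : (⨆ l, ⨆ (_ : σ l = k), trace A (Δ l) (M ⧸ tower Δ σ M k)) = ⊥ := by
      refine le_bot_iff.1 (iSup₂_le fun l hl => trace_le fun f x => ?_)
      have hf := h l (by omega) ((Submodule.quotEquivOfEqBot _ hb).toLinearMap ∘ₗ f)
      exact (Submodule.quotEquivOfEqBot _ hb).injective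
        ((LinearMap.congr_fun hf x).trans (map_zero _).symm)
    rw [tower, this, Submodule.comap_bot, Submodule.ker_mkQ, hb]

end Tower

/-! ### Towers of standard modules and of their projective covers -/

section Data

variable (R : Type u) [CommRing R] {A : Type u} [Ring A] [Algebra R A]
  {Λ : Type w} [PartialOrder Λ]

/-- The data extracted from a split quasi-hereditary structure: projective covers, and an
injective numbering of the index set which reverses the order. -/
structure SplitData (Δ : Λ → ModuleCat.{u} A) where
  P : Λ → ModuleCat.{u} A
  π : ∀ l, P l →ₗ[A] Δ l
  rank : Λ → ℕ
  rank_injective : Function.Injective rank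
  rank_lt : ∀ {l μ}, l < μ → rank μ < rank l
  P_finite : ∀ l, Module.Finite A (P l)
  P_projective : ∀ l, Module.Projective A (P l)
  π_surjective : ∀ l, Function.Surjective (π l)
  ker_filt : ∀ l, Filt Δ (Set.Ioi l) (LinearMap.ker (π l))
  hom_eq_zero : ∀ {l μ} (f : Δ l →ₗ[A] Δ μ), ¬ l ≤ μ → f = 0
  end_bijective : ∀ l, Function.Bijective (algebraMap R (Module.End A (Δ l)))
  finite : ∀ l, Module.Finite R (Δ l)
  projective : ∀ l, Module.Projective R (Δ l)
  exists_sum : ∃ (m : ℕ) (l : Fin m → Λ) (i : ∀ s, A →ₗ[A] P (l s)) (p : ∀ s, P (l s) →ₗ[A] A),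
    ∀ a, ∑ s, p s (i s a) = a

attribute [instance] SplitData.P_finite SplitData.P_projective

variable {R} {Δ : Λ → ModuleCat.{u} A}

namespace SplitData

variable (d : SplitData R Δ)

/-- The step of the tower below `Δ l`, as a quotient. -/
abbrev Q (M : Type u) [AddCommGroup M] [Module A M] (k : ℕ) : Type u := TowerQuot Δ d.rank M k

lemma P_filt (l : Λ) : Filt Δ (Set.Ici l) (d.P l) :=
  .ext (LinearMap.ker (d.π l)).subtype (d.π l) Subtype.val_injective (d.π_surjective l)
    (fun y => by simp) l Set.self_mem_Ici
    ⟨1, fun _ => LinearMap.id, fun _ => LinearMap.id, fun y => by simp⟩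
    ((d.ker_filt l).mono fun _ h => le_of_lt h)

lemma not_lt_of_rank_le {l μ : Λ} (h : d.rank l ≤ d.rank μ) : ¬ l < μ := fun hlt =>
  absurd (d.rank_lt hlt) (by omega)

variable {M : Type u} [AddCommGroup M] [Module A M]

lemma step (d : SplitData R Δ) {S : Set Λ} {l : Λ} (hS : ∀ μ ∈ S, ¬ l < μ) (h : Filt Δ S M) [Module R M]
    [IsScalarTower R A M] :
    (Module.Finite R (Δ l →ₗ[A] M) ∧ Module.Projective R (Δ l →ₗ[A] M)) ∧
      Function.Injective (ev R A (Δ l) M) ∧ Filt Δ (S \ {l}) (M ⧸ trace A (Δ l) M) :=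
  Filt.step (d.end_bijective l) (fun l μ ⟨f, hf⟩ => by
    by_contra hle
    exact hf (d.hom_eq_zero f hle)) (d.π l) (d.π_surjective l) (d.ker_filt l) hS h

/-- Each step of the tower removes by `Filt.step` the factors of rank k. That lemma applies because
the surviving indices have rank at least k, so none of them lies above the one being removed. -/
lemma filt_towerQuot {S : Set Λ} (h : Filt Δ S M) (k : ℕ) :
    Filt Δ (S ∩ {μ | k ≤ d.rank μ}) (d.Q M k) := by
  let _ : Module R M := Module.compHom M (algebraMap R A)
  have : IsScalarTower R A M := ⟨fun r a x => by rw [Algebra.smul_def, mul_smul]; rfl⟩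
  induction k with
  | zero =>
    exact (h.mono (fun μ hμ => ⟨hμ, Nat.zero_le _⟩ : S ⊆ S ∩ {μ | 0 ≤ d.rank μ})).of_equiv
      (Submodule.quotEquivOfEqBot _ rfl).symm
  | succ k ih =>
    by_cases hk : ∃ l, d.rank l = k
    · obtain ⟨l, rfl⟩ := hk
      have hf := (d.step (l := l) (fun μ hμ => d.not_lt_of_rank_le hμ.2) ih).2.2
      let g : M →ₗ[A] d.Q M (d.rank l) ⧸ trace A (Δ l) (d.Q M (d.rank l)) :=
        (trace A (Δ l) (d.Q M (d.rank l))).mkQ ∘ₗ TowerQuot.mk Δ d.rank M (d.rank l)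
      have hg : Function.Surjective g :=
        (Submodule.mkQ_surjective _).comp (TowerQuot.mk_surjective _ _ _)
      have hker : tower Δ d.rank M (d.rank l + 1) = LinearMap.ker g := by
        rw [tower_succ d.rank_injective, LinearMap.ker_comp, Submodule.ker_mkQ]
      refine (hf.mono ?_).of_equiv
        ((Submodule.quotEquivOfEq _ _ hker) ≪≫ₗ g.quotKerEquivOfSurjective hg).symm
      rintro μ ⟨⟨h1, h2⟩, h3⟩
      exact ⟨h1, lt_of_le_of_ne h2 fun he => h3 (d.rank_injective he).symm⟩
    · push Not at hk
      refine (ih.mono ?_).of_equiv (Submodule.quotEquivOfEq _ _ (tower_succ_of_forall_ne hk).symm)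
      rintro μ ⟨h1, h2⟩
      exact ⟨h1, lt_of_le_of_ne h2 (hk μ).symm⟩

lemma hom_towerQuot {S : Set Λ} (h : Filt Δ S M) (l : Λ) [Module R M] [IsScalarTower R A M] :
    (Module.Finite R (Δ l →ₗ[A] d.Q M (d.rank l)) ∧
      Module.Projective R (Δ l →ₗ[A] d.Q M (d.rank l))) ∧
      Function.Injective (ev R A (Δ l) (d.Q M (d.rank l))) := by
  have := d.step (l := l) (fun μ hμ => d.not_lt_of_rank_le hμ.2) (d.filt_towerQuot h (d.rank l))
  exact ⟨this.1, this.2.1⟩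

/-- A nonzero map Δ(μ) → Δ(l) needs μ ≤ l, hence rank μ ≥ rank l. By functoriality the k-th ideal of
the tower of A then annihilates Δ(l). -/
lemma tower_std_eq_bot {l : Λ} {k : ℕ} (hk : k ≤ d.rank l) : tower Δ d.rank (Δ l) k = ⊥ :=
  tower_eq_bot fun μ hμ f => d.hom_eq_zero f fun hle => by
    rcases hle.lt_or_eq with h | h
    · exact absurd (d.rank_lt h) (by omega)
    · subst h; omega

/-- One inclusion is functoriality along `π`, the tower of Δ(l) being still zero at this step. For
the other, all factors of the kernel have index above l, hence rank below that of l, so the kernel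
is exhausted by its own tower. -/
lemma tower_P (l : Λ) : tower Δ d.rank (d.P l) (d.rank l) = LinearMap.ker (d.π l) := by
  apply le_antisymm
  · have := tower_le_comap (Δ := Δ) (σ := d.rank) (d.π l) (d.rank l)
    rwa [d.tower_std_eq_bot le_rfl] at this
  · have hempty : Set.Ioi l ∩ {μ | d.rank l ≤ d.rank μ} = ∅ :=
      Set.eq_empty_of_forall_notMem fun μ hμ => d.not_lt_of_rank_le hμ.2 hμ.1
    have hf := d.filt_towerQuot (d.ker_filt l) (d.rank l)
    rw [hempty] at hf
    have htop : tower Δ d.rank (LinearMap.ker (d.π l)) (d.rank l) = ⊤ :=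
      Submodule.Quotient.subsingleton_iff.1 hf.subsingleton
    intro x hx
    exact map_mem_tower (LinearMap.ker (d.π l)).subtype
      (show (⟨x, hx⟩ : LinearMap.ker (d.π l)) ∈ _ by rw [htop]; trivial)

/-- The identification of `Δ l` with the quotient of its projective cover. -/
lemma exists_section (l : Λ) : ∃ ι : Δ l →ₗ[A] d.Q (d.P l) (d.rank l),
    Function.Bijective ι ∧ ∀ x, ι (d.π l x) = TowerQuot.mk Δ d.rank (d.P l) (d.rank l) x := by
  obtain ⟨ι, hι⟩ := exists_desc_of_surjective (d.π l) (d.π_surjective l)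
    (TowerQuot.mk Δ d.rank (d.P l) (d.rank l)) fun y hy => by
      rw [TowerQuot.mk_eq_zero, d.tower_P]
      exact hy
  refine ⟨ι, ⟨?_, fun y => ?_⟩, LinearMap.congr_fun hι⟩
  · rw [injective_iff_map_eq_zero]
    intro y hy
    obtain ⟨x, rfl⟩ := d.π_surjective l y
    rw [← LinearMap.comp_apply, hι, TowerQuot.mk_eq_zero, d.tower_P] at hy
    exact hy
  · obtain ⟨x, rfl⟩ := TowerQuot.mk_surjective _ _ _ y
    exact ⟨d.π l x, LinearMap.congr_fun hι x⟩

/-- The identification of `Δ l` with the quotient of its projective cover. -/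
noncomputable def ι (l : Λ) : Δ l →ₗ[A] d.Q (d.P l) (d.rank l) := (d.exists_section l).choose

lemma ι_bijective (l : Λ) : Function.Bijective (d.ι l) := (d.exists_section l).choose_spec.1

@[simp] lemma ι_π (l : Λ) (x : d.P l) :
    d.ι l (d.π l x) = TowerQuot.mk Δ d.rank (d.P l) (d.rank l) x :=
  (d.exists_section l).choose_spec.2 x

/-- The quotient is filtered by Δ(κ) with κ ≥ l and rank κ ≥ rank μ. A nonzero map from Δ(μ) needs μ
≤ κ, which leaves only κ = μ, excluded by `h`. -/
lemma hom_towerQuot_P_eq_zero {l μ : Λ} (h : ¬ l ≤ μ)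
    (f : Δ μ →ₗ[A] d.Q (d.P l) (d.rank μ)) : f = 0 :=
  (d.filt_towerQuot (d.P_filt l) (d.rank μ)).hom_eq_zero_right (fun κ hκ g =>
    d.hom_eq_zero g fun hle => by
      rcases hle.lt_or_eq with h' | h'
      · exact d.not_lt_of_rank_le hκ.2 h'
      · subst h'; exact h hκ.1) f

lemma hom_P_eq_zero {l μ : Λ} (h : ¬ l ≤ μ) (f : d.P l →ₗ[A] Δ μ) : f = 0 :=
  (d.P_filt l).hom_eq_zero_left (fun _ hκ g => d.hom_eq_zero g fun hle => h (le_trans hκ hle)) f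

end SplitData

end Data

end SplitQH

namespace SplitQH

/-! ### Right module structure on quotients of A, and their action on modules -/

section RightAction

variable {R : Type u} [CommRing R] {A : Type u} [Ring A] [Algebra R A] {Λ : Type w}
  {Δ : Λ → ModuleCat.{u} A} {σ : Λ → ℕ}
variable {M N : Type u} [AddCommGroup M] [Module A M] [AddCommGroup N] [Module A N]

lemma exists_dualBasis (P : Type*) [AddCommGroup P] [Module A P] [Module.Finite A P]
    [Module.Projective A P] :
    ∃ (m : ℕ) (f : Fin m → P →ₗ[A] A) (x : Fin m → P), ∀ y, ∑ s, f s y • x s = y := by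
  obtain ⟨m, i, p, hp⟩ := IsSumRetract.of_projective (A := A) (N := P)
  refine ⟨m, i, fun s => p s 1, fun y => ?_⟩
  simpa [← map_smul] using hp y

lemma sum_dualBasis {P : Type*} [AddCommGroup P] [Module A P] {m : ℕ} {f : Fin m → P →ₗ[A] A}
    {x : Fin m → P} (h : ∀ y, ∑ s, f s y • x s = y) (φ : P →ₗ[A] A) :
    ∑ s, MulOpposite.op (φ (x s)) • f s = φ := by
  ext y
  conv_rhs => rw [← h y]
  simp

namespace TowerQuot

instance (k : ℕ) : Module Aᵐᵒᵖ (TowerQuot Δ σ A k) where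
  smul a x := map (LinearMap.toSpanSingleton A A a.unop) k x
  one_smul x := by
    obtain ⟨x, rfl⟩ := mk_surjective Δ σ k x
    exact congrArg (mk Δ σ A k) (mul_one x)
  mul_smul a b x := by
    obtain ⟨x, rfl⟩ := mk_surjective Δ σ k x
    exact congrArg (mk Δ σ A k) (mul_assoc x b.unop a.unop).symm
  smul_zero a := map_zero _
  smul_add a x y := map_add _ _ _
  add_smul a b x := by
    obtain ⟨x, rfl⟩ := mk_surjective Δ σ k x
    exact (congrArg (mk Δ σ A k) (mul_add x a.unop b.unop)).trans (map_add _ _ _)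
  zero_smul x := by
    obtain ⟨x, rfl⟩ := mk_surjective Δ σ k x
    exact (congrArg (mk Δ σ A k) (mul_zero x)).trans (map_zero _)

lemma op_smul_def (k : ℕ) (a : Aᵐᵒᵖ) (x : TowerQuot Δ σ A k) :
    a • x = map (LinearMap.toSpanSingleton A A a.unop) k x := rfl

lemma op_smul_mk (k : ℕ) (a : Aᵐᵒᵖ) (x : A) :
    a • mk Δ σ A k x = mk Δ σ A k (x * a.unop) := rfl

instance (k : ℕ) : SMulCommClass A Aᵐᵒᵖ (TowerQuot Δ σ A k) where
  smul_comm a b x := (map_smul (map (LinearMap.toSpanSingleton A A b.unop) k) a x).symm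

instance (k : ℕ) : IsScalarTower R Aᵐᵒᵖ (TowerQuot Δ σ A k) where
  smul_assoc r a x := by
    obtain ⟨x, rfl⟩ := mk_surjective Δ σ k x
    rw [op_smul_mk, op_smul_mk, ← LinearMap.map_smul_of_tower, MulOpposite.unop_smul,
      mul_smul_comm]

/-- If the `k`-th step of the tower of `M` vanishes, an element `x` of `M` induces a map from the
corresponding quotient of `A`. -/
def act {k : ℕ} (h : tower Δ σ M k = ⊥) (x : M) : TowerQuot Δ σ A k →ₗ[A] M :=
  (tower Δ σ A k).liftQ (LinearMap.toSpanSingleton A M x) fun a ha => by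
    have := map_mem_tower (LinearMap.toSpanSingleton A M x) ha
    rw [h] at this
    exact this

@[simp] lemma act_mk {k : ℕ} (h : tower Δ σ M k = ⊥) (x : M) (a : A) :
    act h x (mk Δ σ A k a) = a • x := rfl

lemma act_op_smul {k : ℕ} (h : tower Δ σ M k = ⊥) (x : M) (a : A) (z : TowerQuot Δ σ A k) :
    act h x (MulOpposite.op a • z) = act h (a • x) z := by
  obtain ⟨z, rfl⟩ := mk_surjective Δ σ k z
  rw [op_smul_mk, act_mk, act_mk, MulOpposite.unop_op, mul_smul]

lemma act_add {k : ℕ} (h : tower Δ σ M k = ⊥) (x y : M) : act h (x + y) = act h x + act h y := by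
  ext z
  obtain ⟨z, rfl⟩ := mk_surjective Δ σ k z
  simp

lemma map_act {k : ℕ} (h : tower Δ σ M k = ⊥) (h' : tower Δ σ N k = ⊥) (f : M →ₗ[A] N) (x : M)
    (z : TowerQuot Δ σ A k) : f (act h x z) = act h' (f x) z := by
  obtain ⟨z, rfl⟩ := mk_surjective Δ σ k z
  simp

end TowerQuot

end RightAction

/-! ### The standard modules of the opposite algebra -/

namespace SplitData

open MulOpposite

variable {R : Type u} [CommRing R] {A : Type u} [Ring A] [Algebra R A]
  {Λ : Type w} [PartialOrder Λ] {Δ : Λ → ModuleCat.{u} A} (d : SplitData R Δ)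

/-- The standard modules of the opposite algebra. -/
abbrev E (l : Λ) : Type u := Δ l →ₗ[A] d.Q A (d.rank l)

/-- The projective covers of the standard modules of the opposite algebra. -/
abbrev P' (l : Λ) : Type u := d.P l →ₗ[A] A

/-- All three properties hold for tower quotients of the filtered modules P(μ). They pass to A
because the identity of A is a sum of maps through such modules and the tower is functorial. -/
lemma E_hom_projective (l : Λ) :
    (Module.Finite R (d.E l) ∧ Module.Projective R (d.E l)) ∧
      Function.Injective (ev R A (Δ l) (d.Q A (d.rank l))) := by
  obtain ⟨m, μ, i, p, hp⟩ := d.exists_sum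
  have hsum : ∀ y : d.Q A (d.rank l),
      ∑ s, TowerQuot.map (p s) (d.rank l) (TowerQuot.map (i s) (d.rank l) y) = y := fun y => by
    obtain ⟨y, rfl⟩ := TowerQuot.mk_surjective _ _ _ y
    simp only [TowerQuot.map_mk, ← map_sum, hp]
  have h := fun s => d.hom_towerQuot (d.P_filt (μ s)) l
  exact ⟨hom_projective_of_sum _ _ hsum (fun s => (h s).1.1) (fun s => (h s).1.2),
    ev_injective_of_sum _ _ hsum fun s => (h s).2⟩

instance (l : Λ) : Module.Finite R (d.E l) := (d.E_hom_projective l).1.1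

instance (l : Λ) : Module.Projective R (d.E l) := (d.E_hom_projective l).1.2

/-- The projection of the projective cover of `E l`. -/
noncomputable def π' (l : Λ) : d.P' l →ₗ[Aᵐᵒᵖ] d.E l where
  toFun φ := TowerQuot.map φ (d.rank l) ∘ₗ d.ι l
  map_add' φ ψ := by
    ext x
    obtain ⟨x, rfl⟩ := d.π_surjective l x
    simp
  map_smul' a φ := by
    ext x
    obtain ⟨x, rfl⟩ := d.π_surjective l x
    simp [TowerQuot.op_smul_mk]

@[simp] lemma π'_apply_π (l : Λ) (φ : d.P' l) (x : d.P l) :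
    d.π' l φ (d.π l x) = TowerQuot.mk Δ d.rank A (d.rank l) (φ x) := by
  simp [π']

lemma π'_surjective (l : Λ) : Function.Surjective (d.π' l) := by
  intro e
  obtain ⟨φ, hφ⟩ := Module.projective_lifting_property
    (TowerQuot.mk Δ d.rank A (d.rank l)) (e ∘ₗ d.π l) (TowerQuot.mk_surjective _ _ _)
  refine ⟨φ, ?_⟩
  ext x
  obtain ⟨x, rfl⟩ := d.π_surjective l x
  rw [π'_apply_π]
  exact LinearMap.congr_fun hφ x

lemma π'_eq_zero (l : Λ) (φ : d.P' l) :
    d.π' l φ = 0 ↔ ∀ x, φ x ∈ tower Δ d.rank A (d.rank l) := by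
  constructor
  · intro h x
    rw [← TowerQuot.mk_eq_zero, ← π'_apply_π, h, LinearMap.zero_apply]
  · intro h
    ext x
    obtain ⟨x, rfl⟩ := d.π_surjective l x
    rw [π'_apply_π, (TowerQuot.mk_eq_zero _ _).2 (h x), LinearMap.zero_apply]

/-- Right linear maps out of `E l` are induced by elements of `Hom(Δ μ, P l / ⋯)`. -/
lemma exists_hom_E {l μ : Λ} (g : d.E l →ₗ[Aᵐᵒᵖ] d.E μ) :
    ∃ ψ : Δ μ →ₗ[A] d.Q (d.P l) (d.rank μ),
      ∀ φ, g (d.π' l φ) = TowerQuot.map φ (d.rank μ) ∘ₗ ψ := by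
  obtain ⟨m, f, x, h⟩ := exists_dualBasis (A := A) (d.P l)
  -- The dual basis gives φ = ∑ f_s · φ(x_s) in the right module P'(l), so `g` is determined by its
  -- values on the `f s`; the witness reassembles these values along the `x s`.
  refine ⟨∑ s, TowerQuot.map (LinearMap.toSpanSingleton A (d.P l) (x s)) (d.rank μ) ∘ₗ
    g (d.π' l (f s)), fun φ => ?_⟩
  conv_lhs => rw [← sum_dualBasis h φ]
  ext y
  simp only [map_sum, map_smul, LinearMap.sum_apply, LinearMap.smul_apply, LinearMap.comp_apply,
    TowerQuot.op_smul_def, TowerQuot.map_map]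
  refine Finset.sum_congr rfl fun s _ => ?_
  congr 2
  ext
  simp

lemma hom_E_eq_zero {l μ : Λ} (h : ¬ l ≤ μ) (g : d.E l →ₗ[Aᵐᵒᵖ] d.E μ) : g = 0 := by
  obtain ⟨ψ, hψ⟩ := d.exists_hom_E g
  ext1 e
  obtain ⟨φ, rfl⟩ := d.π'_surjective l e
  rw [hψ, d.hom_towerQuot_P_eq_zero h ψ, LinearMap.comp_zero, LinearMap.zero_apply]

lemma smul_injective (d : SplitData R Δ) {l : Λ} {r : R} (h : ∀ x : Δ l, r • x = 0) : r = 0 :=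
  (d.end_bijective l).1 (by
    rw [map_zero]
    ext x
    exact h x)

lemma E_end_bijective (l : Λ) : Function.Bijective (algebraMap R (Module.End Aᵐᵒᵖ (d.E l))) := by
  constructor
  · rw [injective_iff_map_eq_zero]
    intro r hr
    have hr' : ∀ e : d.E l, r • e = 0 := LinearMap.congr_fun hr
    refine d.smul_injective (l := l) fun y => (d.ι_bijective l).1 ?_
    obtain ⟨m, f, x, h⟩ := exists_dualBasis (A := A) (d.P l)
    rw [map_zero, LinearMap.map_smul_of_tower]
    -- The values at `y` of the elements `π' (f s)` recover `y`, so a scalar killing E(l) also kills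
    -- Δ(l).
    have hid : d.ι l y = ∑ s, TowerQuot.map (LinearMap.toSpanSingleton A (d.P l) (x s))
        (d.rank l) (d.π' l (f s) y) := by
      obtain ⟨y, rfl⟩ := d.π_surjective l y
      simp only [ι_π, π'_apply_π, TowerQuot.map_mk, ← map_sum,
        LinearMap.toSpanSingleton_apply, h]
    rw [hid, Finset.smul_sum]
    refine Finset.sum_eq_zero fun s _ => ?_
    rw [← LinearMap.map_smul_of_tower]
    have := LinearMap.congr_fun (hr' (d.π' l (f s))) y
    rw [show r • d.π' l (f s) y = 0 from this, map_zero]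
  · intro g
    obtain ⟨ψ, hψ⟩ := d.exists_hom_E g
    let e := LinearEquiv.ofBijective (d.ι l) (d.ι_bijective l)
    obtain ⟨r, hr⟩ := (d.end_bijective l).2 (e.symm.toLinearMap ∘ₗ ψ)
    have hr' : ∀ y, ψ y = r • d.ι l y := fun y => by
      have := LinearMap.congr_fun hr y
      have h2 : r • y = e.symm (ψ y) := this
      rw [← LinearMap.map_smul_of_tower, h2]
      exact (e.apply_symm_apply _).symm
    refine ⟨r, ?_⟩
    ext1 z
    obtain ⟨φ, rfl⟩ := d.π'_surjective l z
    rw [hψ]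
    ext y
    rw [LinearMap.comp_apply, hr', LinearMap.map_smul_of_tower]
    rfl

end SplitData

end SplitQH

namespace SplitQH

/-! ### Filtering the kernel of the cover of E(l) -/

section Chain

variable {B : Type u} [Ring B] {M : Type u} [AddCommGroup M] [Module B M]

/-- A submodule is reached by a finite chain with factors in `θ`. -/
def Reached (θ : ModuleCat.{u} B → Prop) (N : Submodule B M) : Prop :=
  ∃ (t : ℕ) (F : ℕ → Submodule B M), Monotone F ∧ F 0 = ⊥ ∧ F t = N ∧
    ∀ i < t, ∃ X : ModuleCat.{u} B, θ X ∧
      Nonempty ((F (i + 1) ⧸ (F i).submoduleOf (F (i + 1))) ≃ₗ[B] X)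

lemma Reached.bot (θ : ModuleCat.{u} B → Prop) : Reached θ (⊥ : Submodule B M) :=
  ⟨0, fun _ => ⊥, monotone_const, rfl, rfl, fun i hi => absurd hi (by omega)⟩

lemma Reached.step {θ : ModuleCat.{u} B → Prop} {N N' : Submodule B M} (h : Reached θ N)
    (hle : N ≤ N') {X : ModuleCat.{u} B} (hX : θ X) (e : (N' ⧸ N.submoduleOf N') ≃ₗ[B] X) :
    Reached θ N' := by
  obtain ⟨t, F, hF, h0, ht, hf⟩ := h
  refine ⟨t + 1, fun i => if i ≤ t then F i else N', fun i j hij => ?_, by simp [h0], by simp,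
    fun i hi => ?_⟩
  · by_cases hj : j ≤ t
    · simp only [hj, hij.trans hj, if_true]
      exact hF hij
    · by_cases hi : i ≤ t
      · simp only [hj, hi, if_true, if_false]
        exact (hF hi).trans (ht.le.trans hle)
      · simp [hj, hi]
  · rcases (Nat.lt_succ_iff.1 hi).lt_or_eq with hi | rfl
    · have h1 : i + 1 ≤ t := hi
      have h2 : i ≤ t := hi.le
      beta_reduce
      rw [if_pos h1, if_pos h2]
      exact hf i hi
    · refine ⟨X, hX, ⟨?_⟩⟩
      have h1 : (if i + 1 ≤ i then F (i + 1) else N') = N' := by simp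
      have h2 : (if i ≤ i then F i else N') = N := by simp [ht]
      beta_reduce
      rw [h1, h2]
      exact e

lemma Reached.step_of_range_eq {θ : ModuleCat.{u} B → Prop} {N N' : Submodule B M}
    (h : Reached θ N) (hle : N ≤ N') {Y Z : Type u} [AddCommGroup Y] [Module B Y] [AddCommGroup Z]
    [Module B Z] (f : N' →ₗ[B] Y) (hf : LinearMap.ker f = N.submoduleOf N') (g : Z →ₗ[B] Y)
    (hg : Function.Injective g) (hfg : LinearMap.range f = LinearMap.range g)
    (hZ : θ (ModuleCat.of B Z)) : Reached θ N' :=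
  h.step hle hZ (Submodule.quotEquivOfEq _ _ hf.symm ≪≫ₗ f.quotKerEquivRange ≪≫ₗ
    LinearEquiv.ofEq _ _ hfg ≪≫ₗ (LinearEquiv.ofInjective g hg).symm)

lemma Reached.hasFiltration {θ : ModuleCat.{u} B → Prop} (h : Reached θ (⊤ : Submodule B M)) :
    HasFiltration B θ M := h

end Chain

namespace SplitData

open MulOpposite

variable {R : Type u} [CommRing R] {A : Type u} [Ring A] [Algebra R A]
  {Λ : Type w} [PartialOrder Λ] {Δ : Λ → ModuleCat.{u} A} (d : SplitData R Δ)

/-- The map `y ↦ f y • z` attached to a functional `f`. -/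
def smulMap {P M : Type u} [AddCommGroup P] [Module A P] [AddCommGroup M] [Module A M]
    [Module R M] [IsScalarTower R A M] (f : P →ₗ[A] A) : M →ₗ[R] (P →ₗ[A] M) where
  toFun z := LinearMap.toSpanSingleton A M z ∘ₗ f
  map_add' z z' := by ext; simp
  map_smul' r z := by ext; simp [smul_algebra_smul_comm]

/-- Evaluation at an element, as an `R`-linear map. -/
def evalMap {P M : Type u} [AddCommGroup P] [Module A P] [AddCommGroup M] [Module A M]
    [Module R M] [IsScalarTower R A M] (x : P) : (P →ₗ[A] M) →ₗ[R] M where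
  toFun h := h x
  map_add' _ _ := rfl
  map_smul' _ _ := rfl

lemma sum_smulMap_evalMap {P M : Type u} [AddCommGroup P] [Module A P] [AddCommGroup M]
    [Module A M] [Module R M] [IsScalarTower R A M] {m : ℕ} {f : Fin m → P →ₗ[A] A}
    {x : Fin m → P} (h : ∀ y, ∑ s, f s y • x s = y) (g : P →ₗ[A] M) :
    ∑ s, smulMap (R := R) (f s) (evalMap (R := R) (x s) g) = g := by
  ext y
  conv_rhs => rw [← h y]
  simp [smulMap, evalMap]

lemma hom_isSumRetract (P M : Type u) [AddCommGroup P] [Module A P] [Module.Finite A P]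
    [Module.Projective A P] [AddCommGroup M] [Module A M] [Module R M] [IsScalarTower R A M] :
    IsSumRetract R M (P →ₗ[A] M) := by
  obtain ⟨m, f, x, h⟩ := exists_dualBasis (A := A) P
  exact ⟨m, fun s => evalMap (x s), fun s => smulMap (f s), sum_smulMap_evalMap h⟩

/-- Composition, as a map from the tensor product. -/
def compMap (l μ : Λ) :
    d.E μ ⊗[R] (d.P l →ₗ[A] Δ μ) →ₗ[Aᵐᵒᵖ] (d.P l →ₗ[A] d.Q A (d.rank μ)) :=
  TensorProduct.AlgebraTensorModule.lift
    { toFun := fun e =>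
        { toFun := fun h => e ∘ₗ h
          map_add' := fun h h' => LinearMap.comp_add _ _ _
          map_smul' := fun r h => by
            ext x
            exact LinearMap.map_smul_of_tower e r (h x) }
      map_add' := fun e e' => by ext h; rfl
      map_smul' := fun a e => by ext h; rfl }

@[simp] lemma compMap_tmul (l μ : Λ) (e : d.E μ) (h : d.P l →ₗ[A] Δ μ) :
    d.compMap l μ (e ⊗ₜ h) = e ∘ₗ h := rfl

lemma compMap_apply (l μ : Λ) (z : d.E μ ⊗[R] (d.P l →ₗ[A] Δ μ)) (x : d.P l) :
    d.compMap l μ z x =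
      ev R A (Δ μ) _ (TensorProduct.comm R _ _ ((evalMap (R := R) x).lTensor (d.E μ) z)) := by
  induction z with
  | zero => simp
  | add y z hy hz => simp only [map_add, LinearMap.add_apply, hy, hz]
  | tmul e h => rfl

/-- Evaluating at a dual basis of P(l) reduces the claim to injectivity of the evaluation Δ(μ) ⊗
E(μ) → A/J. -/
lemma compMap_injective (l μ : Λ) : Function.Injective (d.compMap l μ) := by
  obtain ⟨m, f, x, h⟩ := exists_dualBasis (A := A) (d.P l)
  rw [injective_iff_map_eq_zero]
  intro z hz
  have hsum : ∑ s, (smulMap (R := R) (f s)).lTensor (d.E μ)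
      ((evalMap (R := R) (x s)).lTensor (d.E μ) z) = z := by
    clear hz
    induction z with
    | zero => simp
    | add y z hy hz => simp only [map_add, Finset.sum_add_distrib, hy, hz]
    | tmul e g =>
      simp only [LinearMap.lTensor_tmul, ← TensorProduct.tmul_sum, sum_smulMap_evalMap h]
  rw [← hsum]
  refine Finset.sum_eq_zero fun s _ => ?_
  have h1 := d.compMap_apply l μ z (x s)
  rw [hz, LinearMap.zero_apply] at h1
  have h2 := (d.E_hom_projective μ).2 (h1.symm.trans (map_zero _).symm)
  rw [(TensorProduct.comm R _ _).injective (h2.trans (map_zero _).symm), map_zero]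

lemma mem_range_compMap {l μ : Λ} (g : d.P l →ₗ[A] d.Q A (d.rank μ)) :
    g ∈ LinearMap.range (d.compMap l μ) ↔ ∀ x, g x ∈ trace A (Δ μ) (d.Q A (d.rank μ)) := by
  constructor
  · rintro ⟨z, rfl⟩ x
    rw [compMap_apply, ← range_ev R A]
    exact ⟨_, rfl⟩
  · intro hg
    obtain ⟨m, f, x, h⟩ := exists_dualBasis (A := A) (d.P l)
    rw [← sum_smulMap_evalMap (R := R) h g]
    refine sum_mem fun s _ => ?_
    obtain ⟨w, hw⟩ : evalMap (R := R) (x s) g ∈ LinearMap.range (ev R A (Δ μ) _) := by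
      rw [range_ev]
      exact hg (x s)
    rw [← hw]
    clear hw
    induction w with
    | zero => rw [map_zero, map_zero]; exact zero_mem _
    | add y z hy hz => rw [map_add, map_add]; exact add_mem hy hz
    | tmul y e =>
      refine ⟨e ⊗ₜ smulMap (R := R) (f s) y, ?_⟩
      ext v
      simp [smulMap]

/-- The steps of the filtration of the kernel of `π'`. -/
def kerStep (l : Λ) (k : ℕ) : Submodule Aᵐᵒᵖ (LinearMap.ker (d.π' l)) where
  carrier := {φ | ∀ x, φ.1 x ∈ tower Δ d.rank A k}
  zero_mem' _ := zero_mem _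
  add_mem' h h' x := add_mem (h x) (h' x)
  smul_mem' a _ h x := map_mem_tower (LinearMap.toSpanSingleton A A a.unop) (h x)

lemma kerStep_mono (l : Λ) {k k' : ℕ} (h : k ≤ k') : d.kerStep l k ≤ d.kerStep l k' :=
  fun _ hφ x => tower_mono h (hφ x)

/-- Composition with the projection to the quotient. -/
def kerStepMap (l : Λ) (k k' : ℕ) : d.kerStep l k' →ₗ[Aᵐᵒᵖ] (d.P l →ₗ[A] d.Q A k) where
  toFun φ := TowerQuot.mk Δ d.rank A k ∘ₗ φ.1.1
  map_add' _ _ := LinearMap.comp_add _ _ _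
  map_smul' _ _ := rfl

lemma ker_kerStepMap (l : Λ) (k k' : ℕ) :
    LinearMap.ker (d.kerStepMap l k k') = (d.kerStep l k).submoduleOf (d.kerStep l k') := by
  ext φ
  rw [LinearMap.mem_ker]
  constructor
  · intro h x
    exact (TowerQuot.mk_eq_zero _ _).1 (LinearMap.congr_fun h x)
  · intro h
    ext x
    exact (TowerQuot.mk_eq_zero _ _).2 (h x)

/-- Both sides are the maps from P(l) with values in the layer J_{k+1}/J_k, where k = rank μ.
Projectivity of P(l) lifts such a map to A, and rank μ < rank l puts the lift in the kernel of `π'`.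
-/
lemma range_kerStepMap {l μ : Λ} (h : d.rank μ < d.rank l) :
    LinearMap.range (d.kerStepMap l (d.rank μ) (d.rank μ + 1)) =
      LinearMap.range (d.compMap l μ) := by
  ext g
  rw [mem_range_compMap]
  constructor
  · rintro ⟨φ, rfl⟩ x
    have := φ.2 x
    rw [tower_succ d.rank_injective] at this
    exact this
  · intro hg
    obtain ⟨φ, rfl⟩ := Module.projective_lifting_property (TowerQuot.mk Δ d.rank A (d.rank μ)) g
      (TowerQuot.mk_surjective _ _ _)
    have hφ : ∀ x, φ x ∈ tower Δ d.rank A (d.rank μ + 1) := fun x => by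
      rw [tower_succ d.rank_injective]
      exact hg x
    exact ⟨⟨⟨φ, (d.π'_eq_zero l φ).2 fun x => tower_mono h (hφ x)⟩, hφ⟩, rfl⟩

lemma reached_kerStep (X : Λ → ModuleCat.{u} Aᵐᵒᵖ) (e : ∀ μ, d.E μ ≃ₗ[Aᵐᵒᵖ] X μ) (l : Λ) (k : ℕ)
    (hk : k ≤ d.rank l) : Reached (B := Aᵐᵒᵖ) (M := LinearMap.ker (d.π' l))
      (IsStandardTensorAbove R X l) (d.kerStep l k) := by
  induction k with
  | zero =>
    convert Reached.bot _
    refine le_bot_iff.1 fun φ hφ => Subtype.ext (LinearMap.ext fun x => hφ x)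
  | succ k ih =>
    have ih := ih (by omega)
    by_cases hμ : ∃ μ, d.rank μ = k
    · obtain ⟨μ, rfl⟩ := hμ
      by_cases hlt : l < μ
      · have := d.finite μ
        have := d.projective μ
        have hr := hom_isSumRetract (R := R) (A := A) (d.P l) (Δ μ)
        exact ih.step_of_range_eq (d.kerStep_mono l (Nat.le_succ _)) (d.kerStepMap l _ _)
          (d.ker_kerStepMap l _ _) (d.compMap l μ) (d.compMap_injective l μ)
          (d.range_kerStepMap (by omega))
          ⟨μ, hlt, ModuleCat.of R (d.P l →ₗ[A] Δ μ), hr.finite, hr.projective,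
            ⟨TensorProduct.AlgebraTensorModule.congr (e μ) (LinearEquiv.refl R _)⟩⟩
      -- If μ is not above l, then l ≤ μ fails too, since the ranks exclude equality. Hence
      -- Hom(P(l), Δ(μ)) = 0 and the layer is trivial.
      · convert ih using 1
        refine le_antisymm (fun φ hφ => ?_) (d.kerStep_mono l (Nat.le_succ _))
        have h0 : ∀ h : d.P l →ₗ[A] Δ μ, h = 0 := d.hom_P_eq_zero fun hle => by
          rcases hle.lt_or_eq with h | h
          · exact hlt h
          · subst h; omega
        obtain ⟨z, hz⟩ : d.kerStepMap l (d.rank μ) (d.rank μ + 1) ⟨φ, hφ⟩ ∈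
            LinearMap.range (d.compMap l μ) := by
          rw [← d.range_kerStepMap (by omega)]
          exact ⟨_, rfl⟩
        have hz0 : d.compMap l μ z = 0 := by
          clear hz
          induction z with
          | zero => exact map_zero _
          | add y z hy hz => rw [map_add, hy, hz, add_zero]
          | tmul y h => rw [h0 h, TensorProduct.tmul_zero, map_zero]
        have hm : (⟨φ, hφ⟩ : d.kerStep l (d.rank μ + 1)) ∈
            LinearMap.ker (d.kerStepMap l (d.rank μ) (d.rank μ + 1)) := hz.symm.trans hz0
        rw [ker_kerStepMap] at hm
        exact hm
    · push Not at hμ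
      convert ih using 1
      ext φ
      change (∀ x, _) ↔ (∀ x, _)
      rw [tower_succ_of_forall_ne hμ]

lemma ker_π'_hasFiltration (X : Λ → ModuleCat.{u} Aᵐᵒᵖ) (e : ∀ μ, d.E μ ≃ₗ[Aᵐᵒᵖ] X μ) (l : Λ) :
    HasFiltration Aᵐᵒᵖ (IsStandardTensorAbove R X l) (LinearMap.ker (d.π' l)) := by
  have h := d.reached_kerStep X e l (d.rank l) le_rfl
  have htop : d.kerStep l (d.rank l) = ⊤ :=
    eq_top_iff.2 fun φ _ => (d.π'_eq_zero l φ.1).1 φ.2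
  rw [htop] at h
  exact h.hasFiltration

end SplitData

end SplitQH

namespace SplitQH

/-! ### Finiteness of the index set and the opposite quasi-hereditary structure -/

section SumRetractFintype

variable {A : Type*} [Ring A]
variable {X N N' : Type*} [AddCommGroup X] [Module A X] [AddCommGroup N] [Module A N]
  [AddCommGroup N'] [Module A N']

lemma IsSumRetract.of_fintype {ι : Type*} [Fintype ι] (i : ι → N →ₗ[A] X) (p : ι → X →ₗ[A] N)
    (h : ∀ y, ∑ s, p s (i s y) = y) : IsSumRetract A X N := by
  let e := Fintype.equivFin ι
  refine ⟨Fintype.card ι, fun s => i (e.symm s), fun s => p (e.symm s), fun y => ?_⟩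
  rw [e.symm.sum_comp fun s => p s (i s y), h]

lemma IsSumRetract.trans (h : IsSumRetract A X N) (h' : IsSumRetract A N N') :
    IsSumRetract A X N' := by
  obtain ⟨m, i, p, hp⟩ := h
  obtain ⟨m', i', p', hp'⟩ := h'
  refine IsSumRetract.of_fintype (ι := Fin m' × Fin m) (fun s => i s.2 ∘ₗ i' s.1)
    (fun s => p' s.1 ∘ₗ p s.2) fun y => ?_
  simp only [Fintype.sum_prod_type, LinearMap.comp_apply, ← map_sum, hp, hp']

end SumRetractFintype

section Algebra

variable {R : Type u} [CommRing R] {B : Type u} [Ring B] [Algebra R B]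

lemma end_bijective_of_algEquiv {D : Type*} [AddCommGroup D] [Module R D] [Module B D]
    [IsScalarTower R B D] (h : Nonempty (Module.End B D ≃ₐ[R] R)) :
    Function.Bijective (algebraMap R (Module.End B D)) := by
  obtain ⟨e⟩ := h
  have : ⇑(algebraMap R (Module.End B D)) = e.symm := by
    ext1 r
    exact (e.symm.commutes r).symm
  rw [this]
  exact e.symm.bijective

lemma end_bijective_congr {D D' : Type*} [AddCommGroup D] [Module R D] [Module B D]
    [IsScalarTower R B D] [AddCommGroup D'] [Module R D'] [Module B D'] [IsScalarTower R B D']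
    (e : D ≃ₗ[B] D') (h : Function.Bijective (algebraMap R (Module.End B D))) :
    Function.Bijective (algebraMap R (Module.End B D')) := by
  constructor
  · intro r s hrs
    refine h.1 ?_
    ext x
    apply e.injective
    have := LinearMap.congr_fun hrs (e x)
    change r • e x = s • e x at this
    exact (LinearMap.map_smul_of_tower e.toLinearMap r x).trans
      (this.trans (LinearMap.map_smul_of_tower e.toLinearMap s x).symm)
  · intro g
    obtain ⟨r, hr⟩ := h.2 (e.symm.toLinearMap ∘ₗ g ∘ₗ e.toLinearMap)
    refine ⟨r, ?_⟩
    ext x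
    have h1 : r • e.symm x = e.symm (g (e (e.symm x))) := LinearMap.congr_fun hr (e.symm x)
    rw [e.apply_symm_apply] at h1
    apply e.symm.injective
    rw [← h1]
    exact LinearMap.map_smul_of_tower e.symm.toLinearMap r x

end Algebra

section Rank

lemma exists_rank (Λ : Type*) [PartialOrder Λ] [Finite Λ] :
    ∃ σ : Λ → ℕ, Function.Injective σ ∧ ∀ {l μ}, l < μ → σ μ < σ l := by
  have := Fintype.ofFinite Λ
  let _ : Fintype (LinearExtension Λ) := this
  let g := Fintype.orderIsoFinOfCardEq (LinearExtension Λ) rfl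
  let τ : Λ → Fin (Fintype.card (LinearExtension Λ)) := fun l => g.symm (toLinearExtension l)
  have hτ : Function.Injective τ := fun l μ h => g.symm.injective h
  have hmono : Monotone τ := fun l μ h => g.symm.monotone (toLinearExtension.monotone h)
  -- A linear extension read backwards; `τ l` is at most the cardinality minus one, so the truncated
  -- subtraction is exact.
  refine ⟨fun l => Fintype.card (LinearExtension Λ) - 1 - τ l,
    fun l μ h => hτ (Fin.ext ?_), fun {l μ} h => ?_⟩
  · have h1 := (τ l).2
    have h2 := (τ μ).2
    dsimp only at h
    omega
  · have h1 : (τ l : ℕ) < τ μ := lt_of_le_of_ne (hmono h.le) fun he => h.ne (hτ (Fin.ext he))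
    have h2 := (τ μ).2
    dsimp only
    omega

end Rank

section Extraction

variable {R : Type u} [CommRing R] {A : Type u} [Ring A] [Algebra R A]
  {Λ : Type w} [PartialOrder Λ] {Δ : Λ → ModuleCat.{u} A}

lemma nontrivial_of_end [Nontrivial R] {D : Type*} [AddCommGroup D] [Module R D] [Module A D]
    [IsScalarTower R A D] (h : Function.Bijective (algebraMap R (Module.End A D))) :
    Nontrivial D := by
  by_contra hD
  rw [not_nontrivial_iff_subsingleton] at hD
  exact one_ne_zero (α := R) (h.1 (by ext x; exact Subsingleton.elim _ _))

open DirectSum in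
lemma not_finite_directSum (P : ℕ → Type*) [∀ n, AddCommGroup (P n)] [∀ n, Module A (P n)]
    [∀ n, Nontrivial (P n)] : ¬ Module.Finite A (⨁ n, P n) := by
  classical
  intro h
  obtain ⟨S, hS⟩ := h.fg_top
  obtain ⟨n, hn⟩ := Infinite.exists_notMem_finset (S.biUnion fun x => DFinsupp.support x)
  obtain ⟨x, hx⟩ := exists_ne (0 : P n)
  have hle : Submodule.span A (S : Set (⨁ n, P n)) ≤
      LinearMap.ker (DirectSum.component A ℕ P n) := by
    rw [Submodule.span_le]
    intro y hy
    by_contra h0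
    exact hn (Finset.mem_biUnion.2 ⟨y, hy, DFinsupp.mem_support_iff.2 h0⟩)
  rw [hS] at hle
  have := hle (show DirectSum.lof A ℕ P n x ∈ ⊤ by trivial)
  rw [LinearMap.mem_ker, DirectSum.component.lof_self] at this
  exact hx this

open DirectSum in
lemma inAdd_directSum_comp {ι κ : Type*} (P : ι → Type*) [∀ n, AddCommGroup (P n)]
    [∀ n, Module A (P n)] (f : κ → ι) (hf : Function.Injective f) :
    InAdd A (⨁ i, P i) (⨁ k, P (f k)) := by
  classical
  let i : (⨁ k, P (f k)) →ₗ[A] (⨁ i, P i) :=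
    DirectSum.toModule A κ _ fun k => DirectSum.lof A ι P (f k)
  let p : (⨁ i, P i) →ₗ[A] (⨁ k, P (f k)) :=
    { toFun := fun x => DFinsupp.comapDomain f hf x
      map_add' := fun x y => DFinsupp.comapDomain_add f hf x y
      map_smul' := fun a x => DFinsupp.comapDomain_smul f hf a x }
  refine IsSumRetract.inAdd ⟨1, fun _ => i, fun _ => p, fun y => ?_⟩
  have : p ∘ₗ i = LinearMap.id := by
    apply DirectSum.linearMap_ext
    intro k
    refine LinearMap.ext fun x => ?_
    simp only [LinearMap.comp_apply, i, DirectSum.toModule_lof, LinearMap.id_apply]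
    exact (DFinsupp.comapDomain_single f hf k x)
  simpa using LinearMap.congr_fun this y

/-- Every member of add(⨁ P(l)) is finitely generated. For infinite Λ a countable subsum would
belong to it, yet each P(l) is nonzero because it surjects onto Δ(l), whose endomorphism ring is R ≠
0. -/
lemma IsSplitQuasiHereditary.finite_index [Nontrivial R] (h : IsSplitQuasiHereditary R Δ) :
    Finite Λ := by
  by_contra hΛ
  rw [not_finite_iff_infinite] at hΛ
  obtain ⟨P, hP, hadd⟩ := h.exists_projectives
  have hnt : ∀ l, Nontrivial (P l) := fun l => by
    have := nontrivial_of_end (end_bijective_of_algEquiv (h.end_equiv l))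
    obtain ⟨-, -, π, hπ, -⟩ := hP l
    exact hπ.nontrivial
  let f := Infinite.natEmbedding Λ
  have := ((hadd (ModuleCat.of A (DirectSum ℕ fun n => P (f n)))).1
    (inAdd_directSum_comp (fun l => P l) f f.injective)).1
  exact not_finite_directSum (A := A) (fun n => P (f n)) this

lemma IsSplitQuasiHereditary.nonempty_splitData [Finite Λ] (h : IsSplitQuasiHereditary R Δ) :
    Nonempty (SplitData R Δ) := by
  classical
  have := Fintype.ofFinite Λ
  obtain ⟨σ, hσ, hlt⟩ := exists_rank Λ
  obtain ⟨P, hP, hadd⟩ := h.exists_projectives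
  choose hfin hproj π hπ hfilt using hP
  have := h.algebra_finite
  refine ⟨⟨P, π, σ, hσ, hlt, hfin, hproj, hπ, fun l => (hfilt l).filt,
    fun {l μ} f hf => ?_, fun l => end_bijective_of_algEquiv (h.end_equiv l), fun l => ?_,
    h.projective, ?_⟩⟩
  · by_contra h0
    exact hf (h.le_of_hom_ne_zero _ _ ⟨f, h0⟩)
  · have := h.finite l
    exact Module.Finite.trans A (Δ l)
  · obtain ⟨m, i, p, hp⟩ := IsSumRetract.of_inAdd ((hadd (ModuleCat.of A A)).2
      ⟨inferInstanceAs (Module.Finite A A), inferInstanceAs (Module.Projective A A)⟩)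
    let e := Fintype.equivFin (Fin m × Λ)
    refine ⟨Fintype.card (Fin m × Λ), fun s => (e.symm s).2,
      fun s => DirectSum.component A Λ (fun l => P l) (e.symm s).2 ∘ₗ i (e.symm s).1,
      fun s => p (e.symm s).1 ∘ₗ DirectSum.lof A Λ (fun l => P l) (e.symm s).2, fun a => ?_⟩
    refine (e.symm.sum_comp fun s : Fin m × Λ =>
      (p s.1 ∘ₗ DirectSum.lof A Λ (fun l => P l) s.2)
        ((DirectSum.component A Λ (fun l => P l) s.2 ∘ₗ i s.1) a)).trans ?_
    rw [Fintype.sum_prod_type]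
    refine Eq.trans (Finset.sum_congr rfl fun s _ => ?_) (hp a)
    simp only [LinearMap.comp_apply, ← map_sum]
    congr 1
    exact DirectSum.sum_univ_of (i s a)

end Extraction

namespace SplitData

open MulOpposite

variable {R : Type u} [CommRing R] {A : Type u} [Ring A] [Algebra R A]
  {Λ : Type w} [PartialOrder Λ] {Δ : Λ → ModuleCat.{u} A} (d : SplitData R Δ)

/-- Evaluation at `x`, as a map of right modules. -/
def evalOp {P : Type u} [AddCommGroup P] [Module A P] (x : P) :
    (P →ₗ[A] A) →ₗ[Aᵐᵒᵖ] Aᵐᵒᵖ where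
  toFun φ := op (φ x)
  map_add' _ _ := rfl
  map_smul' _ _ := rfl

lemma P'_isSumRetract (l : Λ) : IsSumRetract Aᵐᵒᵖ Aᵐᵒᵖ (d.P' l) := by
  obtain ⟨m, f, x, h⟩ := exists_dualBasis (A := A) (d.P l)
  exact ⟨m, fun s => evalOp (x s), fun s => LinearMap.toSpanSingleton Aᵐᵒᵖ _ (f s),
    sum_dualBasis h⟩

-- Transpose of `exists_sum`: since 1 = ∑ p_s(i_s(1)), the identity of the opposite ring is the sum
-- of the maps b ↦ p_s · b followed by evaluation at i_s(1).
open DirectSum in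
lemma ring_isSumRetract : IsSumRetract Aᵐᵒᵖ (⨁ l, d.P' l) Aᵐᵒᵖ := by
  classical
  obtain ⟨m, l, i, p, h⟩ := d.exists_sum
  refine ⟨m, fun s => DirectSum.lof Aᵐᵒᵖ Λ d.P' (l s) ∘ₗ
      LinearMap.toSpanSingleton Aᵐᵒᵖ (d.P' (l s)) (p s),
    fun s => evalOp (i s 1) ∘ₗ DirectSum.component Aᵐᵒᵖ Λ d.P' (l s), fun b => ?_⟩
  simp only [LinearMap.comp_apply, DirectSum.component.lof_self]
  change ∑ s, op (p s (i s 1) * b.unop) = b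
  rw [← Finset.op_sum, ← Finset.sum_mul, h, one_mul, op_unop]

theorem isSplitQuasiHereditary_op [Finite Λ] (hN : IsNoetherianRing R) [Module.Finite R A]
    [Module.Projective R A] (X : Λ → ModuleCat.{u} Aᵐᵒᵖ) (e : ∀ μ, d.E μ ≃ₗ[Aᵐᵒᵖ] X μ) :
    IsSplitQuasiHereditary R X where
  noetherian := hN
  algebra_finite := Module.Finite.equiv (opLinearEquiv R : A ≃ₗ[R] Aᵐᵒᵖ)
  algebra_projective := Module.Projective.of_equiv (opLinearEquiv R : A ≃ₗ[R] Aᵐᵒᵖ)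
  finite l := by
    have := Module.Finite.of_restrictScalars_finite R Aᵐᵒᵖ (d.E l)
    exact Module.Finite.equiv (e l)
  projective l := Module.Projective.of_equiv ((e l).restrictScalars R)
  le_of_hom_ne_zero l μ := by
    rintro ⟨f, hf⟩
    by_contra hle
    refine hf ?_
    have := d.hom_E_eq_zero hle ((e μ).symm.toLinearMap ∘ₗ f ∘ₗ (e l).toLinearMap)
    ext x
    have h1 := LinearMap.congr_fun this ((e l).symm x)
    simpa using h1
  end_equiv l := ⟨(AlgEquiv.ofBijective (Algebra.ofId R _)
    (end_bijective_congr (e l) (d.E_end_bijective l))).symm⟩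
  exists_projectives := by
    refine ⟨fun l => ModuleCat.of Aᵐᵒᵖ (d.P' l), fun l => ⟨(d.P'_isSumRetract l).finite,
      (d.P'_isSumRetract l).projective, (e l).toLinearMap ∘ₗ d.π' l,
      (e l).surjective.comp (d.π'_surjective l), ?_⟩, fun Q => ⟨fun hQ => ?_, ?_⟩⟩
    · rw [LinearEquiv.ker_comp]
      exact d.ker_π'_hasFiltration X e l
    · have h1 : ∀ l, Module.Finite Aᵐᵒᵖ (d.P' l) := fun l => (d.P'_isSumRetract l).finite
      have h2 : ∀ l, Module.Projective Aᵐᵒᵖ (d.P' l) := fun l => (d.P'_isSumRetract l).projective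
      have h3 : Module.Finite Aᵐᵒᵖ (DirectSum Λ d.P') := by
        classical
        have := Fintype.ofFinite Λ
        exact Module.Finite.equiv (DFinsupp.linearEquivFunOnFintype (R := Aᵐᵒᵖ) (M := d.P')).symm
      have hQ' : IsSumRetract Aᵐᵒᵖ (DirectSum Λ d.P') Q := .of_inAdd hQ
      exact ⟨hQ'.finite, hQ'.projective⟩
    · rintro ⟨_, _⟩
      exact (d.ring_isSumRetract.trans (IsSumRetract.of_projective (A := Aᵐᵒᵖ) (N := Q))).inAdd

end SplitData

end SplitQH

namespace SplitQH

/-! ### The costandard modules: homomorphisms and extension of maps -/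

namespace SplitData

open MulOpposite

variable {R : Type u} [CommRing R] {A : Type u} [Ring A] [Algebra R A]
  {Λ : Type w} [PartialOrder Λ] {Δ : Λ → ModuleCat.{u} A} (d : SplitData R Δ)

/-- The costandard modules. -/
def Nabla (l : Λ) : Type u := d.E l →ₗ[R] R

namespace Nabla

variable {d} {l : Λ}

instance : AddCommGroup (d.Nabla l) := inferInstanceAs (AddCommGroup (d.E l →ₗ[R] R))

/-- The functional underlying an element of a costandard module. -/
def app (f : d.Nabla l) : d.E l →ₗ[R] R := f

@[ext] lemma ext {f g : d.Nabla l} (h : ∀ e, app f e = app g e) : f = g := LinearMap.ext h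

@[simp] lemma app_add (f g : d.Nabla l) (e : d.E l) : app (f + g) e = app f e + app g e := rfl

@[simp] lemma app_zero (e : d.E l) : app (0 : d.Nabla l) e = 0 := rfl

instance : Module A (d.Nabla l) where
  smul a f :=
    { toFun := fun e => app f (op a • e)
      map_add' := fun e e' => by rw [smul_add, map_add]
      map_smul' := fun r e => by rw [smul_comm, map_smul, RingHom.id_apply] }
  one_smul f := ext fun e => congrArg (app f) (one_smul Aᵐᵒᵖ e)
  mul_smul a b f := ext fun e => congrArg (app f) (mul_smul (op b) (op a) e)
  smul_zero a := rfl
  smul_add a f g := rfl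
  add_smul a b f := ext fun e =>
    (congrArg (app f) (add_smul (op a) (op b) e)).trans (map_add (app f) _ _)
  zero_smul f := ext fun e => (congrArg (app f) (zero_smul Aᵐᵒᵖ e)).trans (map_zero (app f))

@[simp] lemma app_smul (a : A) (f : d.Nabla l) (e : d.E l) : app (a • f) e = app f (op a • e) :=
  rfl

lemma app_algebraMap_smul (r : R) (f : d.Nabla l) (e : d.E l) :
    app (algebraMap R A r • f) e = r * app f e := by
  rw [app_smul, show op (algebraMap R A r) = algebraMap R Aᵐᵒᵖ r from rfl, algebraMap_smul,
    map_smul, smul_eq_mul]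

@[simp] lemma app_sum {ι : Type*} (s : Finset ι) (f : ι → d.Nabla l) (e : d.E l) :
    app (∑ i ∈ s, f i) e = ∑ i ∈ s, app (f i) e :=
  LinearMap.sum_apply (M₂ := R) s (fun i => app (f i)) e

end Nabla

open Nabla

/-- The costandard modules as objects of the module category. -/
def nabla (l : Λ) : ModuleCat.{u} A := ModuleCat.of A (d.Nabla l)

/-- If l < μ, a functional φ on P(μ) and y in Δ(l) give the map x ↦ φ(x) • y from P(μ) to Δ(l),
which is zero; a dual basis of P(μ) turns this into g = 0. If `¬ l ≤ μ`, composites of elements of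
E(μ) with maps A → P(l) vanish on tower quotients, so coordinates of elements of P(l) annihilate
E(μ). -/
lemma hom_nabla_eq_zero {l μ : Λ} (h : l ≠ μ) (g : Δ l →ₗ[A] d.Nabla μ) : g = 0 := by
  by_cases hle : l ≤ μ
  · obtain ⟨m, f, x, hfx⟩ := exists_dualBasis (A := A) (d.P μ)
    ext y e
    obtain ⟨φ, rfl⟩ := d.π'_surjective μ e
    rw [← sum_dualBasis hfx φ, map_sum, map_sum, LinearMap.zero_apply, app_zero]
    refine Finset.sum_eq_zero fun s _ => ?_
    rw [map_smul, ← app_smul, ← map_smul]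
    have := LinearMap.congr_fun (d.hom_P_eq_zero (fun h' => h (le_antisymm hle h'))
      (LinearMap.toSpanSingleton A (Δ l) y ∘ₗ φ)) (x s)
    rw [show φ (x s) • y = 0 from this, map_zero, app_zero]
  · obtain ⟨m, f, x, hfx⟩ := exists_dualBasis (A := A) (d.P l)
    ext y e
    obtain ⟨z, rfl⟩ := d.π_surjective l y
    conv_lhs => rw [← hfx z]
    rw [map_sum, map_sum, app_sum, LinearMap.zero_apply, app_zero]
    refine Finset.sum_eq_zero fun s _ => ?_
    rw [map_smul, map_smul, app_smul]
    have h0 := d.hom_towerQuot_P_eq_zero hle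
      (TowerQuot.map (LinearMap.toSpanSingleton A (d.P l) z) (d.rank μ) ∘ₗ e)
    have : op (f s z) • e = 0 := by
      ext v
      have hv := congrArg (TowerQuot.map (f s) (d.rank μ)) (LinearMap.congr_fun h0 v)
      rw [LinearMap.comp_apply, TowerQuot.map_map, LinearMap.zero_apply, map_zero] at hv
      rw [LinearMap.smul_apply, TowerQuot.op_smul_def, LinearMap.zero_apply, ← hv]
      congr 2
      ext
      simp
    rw [this, map_zero]

/-- The scalar by which an endomorphism of a standard module acts. -/
noncomputable def scalar (l : Λ) : Module.End A (Δ l) ≃ₗ[R] R :=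
  (LinearEquiv.ofBijective (Algebra.linearMap R (Module.End A (Δ l))) (d.end_bijective l)).symm

lemma scalar_smul (l : Λ) (f : Module.End A (Δ l)) (y : Δ l) : d.scalar l f • y = f y :=
  LinearMap.congr_fun ((LinearEquiv.ofBijective (Algebra.linearMap R (Module.End A (Δ l)))
    (d.end_bijective l)).apply_symm_apply f) y

lemma tower_std (l : Λ) : tower Δ d.rank (Δ l) (d.rank l) = ⊥ := d.tower_std_eq_bot le_rfl

/-- The canonical map from a standard to a costandard module. -/
noncomputable def canon (l : Λ) : Δ l →ₗ[A] d.Nabla l where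
  toFun x := (d.scalar l).toLinearMap ∘ₗ homMap R (Δ l) (TowerQuot.act (d.tower_std l) x)
  map_add' x y := Nabla.ext fun e => by
    change d.scalar l (TowerQuot.act (d.tower_std l) (x + y) ∘ₗ e) =
      d.scalar l (TowerQuot.act (d.tower_std l) x ∘ₗ e) +
        d.scalar l (TowerQuot.act (d.tower_std l) y ∘ₗ e)
    rw [TowerQuot.act_add, LinearMap.add_comp, map_add]
  map_smul' a x := Nabla.ext fun e => by
    change d.scalar l (TowerQuot.act (d.tower_std l) (a • x) ∘ₗ e) =
      d.scalar l (TowerQuot.act (d.tower_std l) x ∘ₗ (op a • e))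
    congr 1
    ext y
    exact (TowerQuot.act_op_smul (d.tower_std l) x a (e y)).symm

lemma canon_smul (l : Λ) (x : Δ l) (e : d.E l) (y : Δ l) :
    app (d.canon l x) e • y = TowerQuot.act (d.tower_std l) x (e y) :=
  d.scalar_smul l (TowerQuot.act (d.tower_std l) x ∘ₗ e) y

lemma canon_π'_smul_π (l : Λ) (x : Δ l) (φ : d.P' l) (y : d.P l) :
    app (d.canon l x) (d.π' l φ) • d.π l y = φ y • x := by
  rw [canon_smul, π'_apply_π, TowerQuot.act_mk]

/-- The scalar is a trace of g over a dual basis of P(l). Expanding φ in that basis,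
`canon_π'_smul_π` replaces φ(x_s) • y by a scalar multiple of the generator π(x_s), and the scalar
does not depend on g. -/
lemma exists_eq_smul_canon (l : Λ) (g : Δ l →ₗ[A] d.Nabla l) :
    ∃ r : R, g = algebraMap R A r • (d.canon l : Δ l → d.Nabla l) := by
  obtain ⟨m, f, x, hfx⟩ := exists_dualBasis (A := A) (d.P l)
  refine ⟨∑ s, app (g (d.π l (x s))) (d.π' l (f s)), funext fun y => Nabla.ext fun e => ?_⟩
  rw [Pi.smul_apply, app_algebraMap_smul]
  obtain ⟨φ, rfl⟩ := d.π'_surjective l e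
  conv_lhs => rw [← sum_dualBasis hfx φ]
  rw [map_sum, map_sum, Finset.sum_mul]
  refine Finset.sum_congr rfl fun s _ => ?_
  rw [map_smul, ← app_smul, ← map_smul, ← d.canon_π'_smul_π l y φ (x s), ← algebraMap_smul A,
    map_smul, app_algebraMap_smul, mul_comm]

lemma eq_zero_of_smul_canon (l : Λ) {r : R} (h : ∀ x e, r * app (d.canon l x) e = 0) : r = 0 := by
  obtain ⟨m, f, x, hfx⟩ := exists_dualBasis (A := A) (d.P l)
  refine d.smul_injective (l := l) fun y => ?_
  obtain ⟨z, rfl⟩ := d.π_surjective l y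
  have : ∑ s, app (d.canon l (d.π l (x s))) (d.π' l (f s)) • d.π l z = d.π l z := by
    simp only [canon_π'_smul_π, ← map_smul, ← map_sum, hfx]
  rw [← this, Finset.smul_sum]
  refine Finset.sum_eq_zero fun s _ => ?_
  rw [← mul_smul, h, zero_smul]

/-- Idempotence of the heredity ideals. The layer J_{k+1}/J_k is generated by images of maps φ :
P(μ) → A, and P(μ) equals step k+1 of its own tower. In φ(p) = ∑ f_s(p) φ(x_s), both factors
therefore lie in J_{k+1}. -/
lemma tower_ring_le_span (k : ℕ) :
    tower Δ d.rank A k ≤ Submodule.span A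
      {a | ∃ j ∈ tower Δ d.rank A k, ∃ j' ∈ tower Δ d.rank A k, a = j * j'} := by
  induction k with
  | zero => exact bot_le
  | succ k ih =>
    have ih' := ih.trans (Submodule.span_mono (t := {a | ∃ j ∈ tower Δ d.rank A (k + 1),
      ∃ j' ∈ tower Δ d.rank A (k + 1), a = j * j'}) fun a ⟨j, hj, j', hj', h⟩ =>
        ⟨j, tower_mono (Nat.le_succ k) hj, j', tower_mono (Nat.le_succ k) hj', h⟩)
    by_cases hμ : ∃ μ, d.rank μ = k
    · obtain ⟨μ, rfl⟩ := hμ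
      have htop : tower Δ d.rank (d.P μ) (d.rank μ + 1) = ⊤ := by
        refine eq_top_iff.2 fun p _ => ?_
        rw [tower_succ d.rank_injective, Submodule.mem_comap, ← ι_π]
        exact mem_trace (d.ι μ) _
      obtain ⟨m, f, x, hfx⟩ := exists_dualBasis (A := A) (d.P μ)
      have hle : trace A (Δ μ) (d.Q A (d.rank μ)) ≤ (Submodule.span A
          {a | ∃ j ∈ tower Δ d.rank A (d.rank μ + 1), ∃ j' ∈ tower Δ d.rank A (d.rank μ + 1),
            a = j * j'}).map (TowerQuot.mk Δ d.rank A (d.rank μ)) := by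
        refine trace_le fun h y => ?_
        obtain ⟨φ, hφ⟩ := Module.projective_lifting_property
          (TowerQuot.mk Δ d.rank A (d.rank μ)) (h ∘ₗ d.π μ) (TowerQuot.mk_surjective _ _ _)
        obtain ⟨p, rfl⟩ := d.π_surjective μ y
        refine ⟨φ p, ?_, LinearMap.congr_fun hφ p⟩
        rw [← hfx p, map_sum]
        refine sum_mem fun s _ => Submodule.subset_span ⟨f s p, map_mem_tower (f s) ?_, φ (x s),
          map_mem_tower φ ?_, ?_⟩
        · rw [htop]; trivial
        · rw [htop]; trivial
        · rw [map_smul, smul_eq_mul]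
      intro a ha
      rw [tower_succ d.rank_injective] at ha
      obtain ⟨b, hb, hab⟩ := hle ha
      have : a - b ∈ tower Δ d.rank A (d.rank μ) := by
        rw [← TowerQuot.mk_eq_zero, map_sub, hab, sub_self]
      rw [← sub_add_cancel a b]
      exact add_mem (ih' this) hb
    · push Not at hμ
      rw [tower_succ_of_forall_ne hμ]
      exact ih

/-- Maps from the kernel of a projective cover to a costandard module extend, when the index of
the costandard module is larger. -/
lemma exists_extension_of_lt {l β : Λ} (h : l < β)
    (f : LinearMap.ker (d.π l) →ₗ[A] d.Nabla β) :
    ∃ F : d.P l →ₗ[A] d.Nabla β, ∀ z, F z.1 = f z := by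
  have := d.projective l
  obtain ⟨t, ht⟩ := Module.projective_lifting_property ((d.π l).restrictScalars R)
    LinearMap.id (d.π_surjective l)
  have ht' : ∀ y, d.π l (t y) = y := LinearMap.congr_fun ht
  let ρ : d.P l →ₗ[R] LinearMap.ker (d.π l) :=
    { toFun := fun z => ⟨z - t (d.π l z), by rw [LinearMap.mem_ker, map_sub, ht', sub_self]⟩
      map_add' := fun z z' => Subtype.ext (by
        simp only [map_add, Submodule.coe_add]; abel)
      map_smul' := fun r z => Subtype.ext (by
        simp [LinearMap.map_smul_of_tower, smul_sub]) }
  have hρ : ∀ z : LinearMap.ker (d.π l), ρ z.1 = z := fun z => Subtype.ext (by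
    change z.1 - t (d.π l z.1) = z.1
    rw [show d.π l z.1 = 0 from z.2, map_zero, sub_zero])
  obtain ⟨m, b, x, hbx⟩ := exists_dualBasis (A := A) (d.P β)
  have hf : ∀ (r : R) z, f (r • z) = algebraMap R A r • f z := fun r z => by
    rw [← map_smul, algebraMap_smul]
  -- Candidate for the extended map, as a form on P(l) × P'(β). The retraction `ρ` is only R-linear,
  -- but it is applied after φ(x_s) has acted, so the form is still A-balanced.
  let B : d.P l → d.P' β →ₗ[R] R := fun z =>
    { toFun := fun φ => ∑ s, app (f (ρ (φ (x s) • z))) (d.π' β (b s))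
      map_add' := fun φ ψ => by
        simp only [LinearMap.add_apply, add_smul, map_add, app_add, Finset.sum_add_distrib]
      map_smul' := fun r φ => by
        simp only [LinearMap.smul_apply, smul_assoc, LinearMap.map_smul ρ, hf,
          app_algebraMap_smul, RingHom.id_apply, smul_eq_mul, Finset.mul_sum] }
  have hB : ∀ z φ, B z φ = ∑ s, app (f (ρ (φ (x s) • z))) (d.π' β (b s)) := fun _ _ => rfl
  have hBadd : ∀ z z' φ, B (z + z') φ = B z φ + B z' φ := fun z z' φ => by
    simp only [hB, smul_add, map_add, app_add, Finset.sum_add_distrib]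
  have hBsmul : ∀ (a : A) z φ, B (a • z) φ = B z (op a • φ) := fun a z φ => by
    simp only [hB, LinearMap.smul_apply, op_smul_eq_mul, mul_smul]
  have hBker : ∀ (z : LinearMap.ker (d.π l)) φ, B z.1 φ = app (f z) (d.π' β φ) := fun z φ => by
    conv_rhs => rw [← sum_dualBasis hbx φ]
    rw [hB, map_sum, map_sum]
    refine Finset.sum_congr rfl fun s _ => ?_
    rw [LinearMap.map_smul (d.π' β), ← app_smul, ← LinearMap.map_smul f]
    exact congrArg (fun v => app (f v) (d.π' β (b s))) (hρ (φ (x s) • z))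
  -- In a product j j', the factor j' moves onto z and sends it into the kernel of `π`, because the
  -- ideal kills Δ(l) when rank β < rank l. There the form is `f` paired through `π'`, which kills ψ
  -- · j. Idempotence makes such products sufficient.
  have hJ : ∀ a ∈ Submodule.span A {a | ∃ j ∈ tower Δ d.rank A (d.rank β),
      ∃ j' ∈ tower Δ d.rank A (d.rank β), a = j * j'}, ∀ z ψ, B z (op a • ψ) = 0 := by
    intro a ha
    induction ha using Submodule.span_induction with
    | zero => intro z ψ; rw [op_zero, zero_smul, map_zero]
    | add a a' _ _ h h' => intro z ψ; rw [MulOpposite.op_add, add_smul, map_add, h, h', add_zero]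
    | smul c a _ h => intro z ψ; rw [smul_eq_mul, op_mul, mul_smul, h]
    | mem a ha =>
      obtain ⟨j, hj, j', hj', rfl⟩ := ha
      intro z ψ
      have hz : j' • z ∈ LinearMap.ker (d.π l) := by
        have h1 := map_mem_tower (LinearMap.toSpanSingleton A (Δ l) (d.π l z)) hj'
        rw [d.tower_std_eq_bot (d.rank_lt h).le] at h1
        rw [LinearMap.mem_ker, map_smul]
        exact h1
      rw [op_mul, mul_smul, ← hBsmul]
      refine (hBker ⟨j' • z, hz⟩ _).trans ?_
      rw [(d.π'_eq_zero β _).2 fun y => ?_, map_zero]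
      exact Submodule.smul_mem _ (ψ y) hj
  have hBzero : ∀ z φ, d.π' β φ = 0 → B z φ = 0 := fun z φ hφ => by
    rw [← sum_dualBasis hbx φ, map_sum]
    exact Finset.sum_eq_zero fun s _ =>
      hJ _ (d.tower_ring_le_span _ ((d.π'_eq_zero β φ).1 hφ (x s))) z (b s)
  have hF : ∀ z, ∃ k : d.E β →ₗ[R] R, ∀ φ, k (d.π' β φ) = B z φ := fun z => by
    obtain ⟨k, hk⟩ := exists_desc_of_surjective ((d.π' β).restrictScalars R) (d.π'_surjective β)
      (B z) (hBzero z)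
    exact ⟨k, LinearMap.congr_fun hk⟩
  choose F hF using hF
  refine ⟨⟨⟨fun z => F z, fun z z' => ?_⟩, fun a z => ?_⟩, fun z => ?_⟩
  · refine Nabla.ext fun e => ?_
    obtain ⟨φ, rfl⟩ := d.π'_surjective β e
    exact (hF _ _).trans ((hBadd _ _ _).trans (congrArg₂ _ (hF _ _) (hF _ _)).symm)
  · refine Nabla.ext fun e => ?_
    obtain ⟨φ, rfl⟩ := d.π'_surjective β e
    refine (hF _ _).trans ((hBsmul _ _ _).trans ?_)
    rw [← hF, map_smul]
    rfl
  · refine Nabla.ext fun e => ?_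
    obtain ⟨φ, rfl⟩ := d.π'_surjective β e
    exact (hF _ _).trans (hBker z φ)

lemma exists_extension (l β : Λ) (f : LinearMap.ker (d.π l) →ₗ[A] d.Nabla β) :
    ∃ F : d.P l →ₗ[A] d.Nabla β, ∀ z, F z.1 = f z := by
  by_cases h : l < β
  · exact d.exists_extension_of_lt h f
  · have hf : f = 0 := (d.ker_filt l).hom_eq_zero_left (fun μ hμ g =>
      d.hom_nabla_eq_zero (fun he => h (by rw [← he]; exact hμ)) g) f
    exact ⟨0, fun z => by rw [hf]; rfl⟩

/-- A costandard module, seen as an `R`-module, is the dual of `E l`. -/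
def nablaEquiv (l : Λ) : d.nabla l ≃ₗ[R] Module.Dual R (d.E l) where
  toFun f := app (d := d) (l := l) f
  invFun f := f
  left_inv _ := rfl
  right_inv _ := rfl
  map_add' _ _ := rfl
  map_smul' r f := by
    ext e
    rw [← algebraMap_smul A r f]
    exact Nabla.app_algebraMap_smul (d := d) r f e

lemma nabla_finite (l : Λ) : Module.Finite A (d.nabla l) := by
  have : Module.Finite R (d.nabla l) := Module.Finite.equiv (d.nablaEquiv l).symm
  exact Module.Finite.of_restrictScalars_finite R A _

/-- The dual of a costandard module is a standard module of the opposite algebra. -/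
noncomputable def dualNablaEquiv (l : Λ) : d.E l ≃ₗ[Aᵐᵒᵖ] dual R (d.nabla l) :=
  letI := dualModuleStructure R (d.nabla l)
  let g : d.E l →ₗ[Aᵐᵒᵖ] (d.nabla l →ₗ[R] R) :=
    { toFun := fun e => Module.Dual.eval R (d.E l) e ∘ₗ (d.nablaEquiv l).toLinearMap
      map_add' := fun e e' => by rw [map_add, LinearMap.add_comp]
      map_smul' := fun a e => rfl }
  -- `g` is the evaluation into the bidual, bijective because E(l) is finitely generated projective
  -- over R.
  LinearEquiv.ofBijective g (by
    have : ⇑g = ((Module.evalEquiv R (d.E l)).trans (d.nablaEquiv l).dualMap) := rfl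
    rw [this]
    exact LinearEquiv.bijective _)

end SplitData

end SplitQH

namespace SplitQH

/-! ### Vanishing of Ext -/

section Ext

open Abelian

variable {A : Type u} [Ring A]

lemma ext_subsingleton_of_subsingleton (X Y : ModuleCat.{u} A) [Subsingleton X] (n : ℕ) :
    Subsingleton (Ext X Y n) := by
  refine subsingleton_of_forall_eq 0 fun x => ?_
  have h0 : 𝟙 X = 0 := by
    ext y
    exact Subsingleton.elim _ _
  rw [← Ext.mk₀_id_comp x, h0, Ext.mk₀_zero, Ext.zero_comp]

lemma ext_zero_subsingleton (X Y : ModuleCat.{u} A) (h : ∀ f : X →ₗ[A] Y, f = 0) :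
    Subsingleton (Ext X Y 0) := by
  have : Subsingleton (X ⟶ Y) := ⟨fun f g => ModuleCat.hom_ext (by rw [h f.hom, h g.hom])⟩
  exact Ext.addEquiv₀.subsingleton

lemma hom_eq_zero_of_ext (X Y : ModuleCat.{u} A) [Subsingleton (Ext X Y 0)] (f : X →ₗ[A] Y) :
    f = 0 := by
  have : Subsingleton (X ⟶ Y) := Ext.addEquiv₀.symm.subsingleton
  exact congrArg ModuleCat.Hom.hom (Subsingleton.elim (ModuleCat.ofHom f) 0)

lemma IsSumRetract.ext_subsingleton {X N Y : ModuleCat.{u} A} (h : IsSumRetract A X N) (n : ℕ)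
    [Subsingleton (Ext X Y n)] : Subsingleton (Ext N Y n) := by
  obtain ⟨m, i, p, hp⟩ := h
  refine subsingleton_of_forall_eq 0 fun x => ?_
  have hid : ∑ s, ModuleCat.ofHom (i s) ≫ ModuleCat.ofHom (p s) = 𝟙 N := by
    ext y
    simpa [ModuleCat.hom_sum] using hp y
  rw [← Ext.mk₀_id_comp x, ← hid, Ext.mk₀_sum, Ext.sum_comp]
  refine Finset.sum_eq_zero fun s _ => ?_
  rw [← Ext.mk₀_comp_mk₀, Ext.comp_assoc_of_second_deg_zero,
    Subsingleton.elim ((Ext.mk₀ (ModuleCat.ofHom (p s))).comp x (zero_add n)) 0, Ext.comp_zero]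

/-- The short complex attached to a short exact sequence of modules. -/
abbrev shortComplex {M' M M'' : Type u} [AddCommGroup M'] [Module A M'] [AddCommGroup M]
    [Module A M] [AddCommGroup M''] [Module A M''] (f : M' →ₗ[A] M) (g : M →ₗ[A] M'')
    (hfg : Function.Exact f g) : ShortComplex (ModuleCat.{u} A) :=
  ShortComplex.mk (ModuleCat.ofHom f) (ModuleCat.ofHom g) (by
    ext y
    exact (hfg _).2 ⟨y, rfl⟩)

lemma shortExact {M' M M'' : Type u} [AddCommGroup M'] [Module A M'] [AddCommGroup M]
    [Module A M] [AddCommGroup M''] [Module A M''] (f : M' →ₗ[A] M) (g : M →ₗ[A] M'')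
    (hf : Function.Injective f) (hg : Function.Surjective g) (hfg : Function.Exact f g) :
    (shortComplex f g hfg).ShortExact where
  exact := (ShortComplex.ShortExact.moduleCat_exact_iff_function_exact _).2 hfg
  mono_f := (ModuleCat.mono_iff_injective _).2 hf
  epi_g := (ModuleCat.epi_iff_surjective _).2 hg

lemma Filt.ext_subsingleton {Λ : Type w} {Δ : Λ → ModuleCat.{u} A} {S : Set Λ} {M : Type u}
    [AddCommGroup M] [Module A M] (h : Filt Δ S M) (Y : ModuleCat.{u} A) (n : ℕ)
    (hS : ∀ μ ∈ S, Subsingleton (Ext (Δ μ) Y n)) : Subsingleton (Ext (ModuleCat.of A M) Y n) := by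
  induction h with
  | zero M h =>
    have : Subsingleton (ModuleCat.of A M) := h
    exact ext_subsingleton_of_subsingleton _ _ _
  | @ext M' M M'' _ _ _ _ _ _ f g hf hg hfg μ hμ h'' h' ih =>
    have := hS μ hμ
    have h1 : Subsingleton (Ext (ModuleCat.of A M'') Y n) :=
      IsSumRetract.ext_subsingleton (X := Δ μ) h'' n
    refine subsingleton_of_forall_eq 0 fun x => ?_
    obtain ⟨y, rfl⟩ := Ext.contravariant_sequence_exact₂ (shortExact f g hf hg hfg) Y x
      (Subsingleton.elim (α := Ext (ModuleCat.of A M') Y n) _ _)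
    rw [Subsingleton.elim (α := Ext (ModuleCat.of A M'') Y n) y 0, Ext.comp_zero]

/-- Maps extend along a monomorphism when `Ext¹` of the cokernel vanishes. -/
lemma exists_extension_of_ext {M' M M'' : Type u} [AddCommGroup M'] [Module A M'] [AddCommGroup M]
    [Module A M] [AddCommGroup M''] [Module A M''] (f : M' →ₗ[A] M) (g : M →ₗ[A] M'')
    (hf : Function.Injective f) (hg : Function.Surjective g) (hfg : Function.Exact f g)
    (Y : ModuleCat.{u} A) [h : Subsingleton (Ext (ModuleCat.of A M'') Y 1)] (k : M' →ₗ[A] Y) :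
    ∃ k' : M →ₗ[A] Y, k' ∘ₗ f = k := by
  obtain ⟨x, hx⟩ := Ext.contravariant_sequence_exact₁ (shortExact f g hf hg hfg) Y
    (Ext.mk₀ (ModuleCat.ofHom k : (shortComplex f g hfg).X₁ ⟶ Y)) (n₁ := 1) rfl
    (Subsingleton.elim (α := Ext (ModuleCat.of A M'') Y 1) _ _)
  obtain ⟨k', rfl⟩ := Ext.mk₀_bijective _ _ |>.2 x
  rw [Ext.mk₀_comp_mk₀] at hx
  have := (Ext.mk₀_bijective _ _).1 hx
  exact ⟨k'.hom, congrArg ModuleCat.Hom.hom this⟩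

/-- `Ext¹` of the cokernel vanishes when maps extend along a monomorphism to a projective. -/
lemma ext_one_subsingleton {M' M M'' : Type u} [AddCommGroup M'] [Module A M'] [AddCommGroup M]
    [Module A M] [AddCommGroup M''] [Module A M''] (f : M' →ₗ[A] M) (g : M →ₗ[A] M'')
    (hf : Function.Injective f) (hg : Function.Surjective g) (hfg : Function.Exact f g)
    [Module.Projective A M] (Y : ModuleCat.{u} A)
    (h : ∀ k : M' →ₗ[A] Y, ∃ k' : M →ₗ[A] Y, k' ∘ₗ f = k) :
    Subsingleton (Ext (ModuleCat.of A M'') Y 1) := by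
  refine subsingleton_of_forall_eq 0 fun x => ?_
  have : Projective (ModuleCat.of A M) := ModuleCat.projective_of_categoryTheory_projective _
  obtain ⟨y, hy⟩ := Ext.contravariant_sequence_exact₃ (shortExact f g hf hg hfg) Y x
    (Ext.eq_zero_of_projective (P := ModuleCat.of A M) _) (n₀ := 0) rfl
  obtain ⟨k, rfl⟩ := (Ext.mk₀_bijective _ _).2 y
  obtain ⟨k', hk'⟩ := h k.hom
  have hk : k = (shortComplex f g hfg).f ≫ ModuleCat.ofHom k' := ModuleCat.hom_ext hk'.symm
  rw [← hy, hk, ← Ext.mk₀_comp_mk₀, ShortComplex.ShortExact.extClass_comp_assoc]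

lemma ext_succ_subsingleton {M' M M'' : Type u} [AddCommGroup M'] [Module A M'] [AddCommGroup M]
    [Module A M] [AddCommGroup M''] [Module A M''] (f : M' →ₗ[A] M) (g : M →ₗ[A] M'')
    (hf : Function.Injective f) (hg : Function.Surjective g) (hfg : Function.Exact f g)
    [Module.Projective A M] (Y : ModuleCat.{u} A) (n : ℕ)
    [Subsingleton (Ext (ModuleCat.of A M') Y n)] :
    Subsingleton (Ext (ModuleCat.of A M'') Y (n + 1)) := by
  refine subsingleton_of_forall_eq 0 fun x => ?_
  have : Projective (ModuleCat.of A M) := ModuleCat.projective_of_categoryTheory_projective _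
  obtain ⟨y, hy⟩ := Ext.contravariant_sequence_exact₃ (shortExact f g hf hg hfg) Y x
    (Ext.eq_zero_of_projective (P := ModuleCat.of A M) _) (n₀ := n) (add_comm 1 n)
  rw [← hy, Subsingleton.elim (α := Ext (ModuleCat.of A M') Y n) y 0, Ext.comp_zero]

end Ext

namespace SplitData

open Abelian Nabla

variable {R : Type u} [CommRing R] {A : Type u} [Ring A] [Algebra R A]
  {Λ : Type w} [PartialOrder Λ] {Δ : Λ → ModuleCat.{u} A} (d : SplitData R Δ)

lemma exact_ker (l : Λ) : Function.Exact (LinearMap.ker (d.π l)).subtype (d.π l) := fun y => by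
  simp

/-- Degree one is the extension property. Higher degrees shift along C(l) → P(l) → Δ(l), by
induction on rank: the factors of C(l) have larger index, hence smaller rank. -/
lemma ext_nabla_succ (l β : Λ) (n : ℕ) : Subsingleton (Ext (Δ l) (d.nabla β) (n + 1)) := by
  induction hk : d.rank l using Nat.strong_induction_on generalizing l n with
  | _ k ih =>
    subst hk
    cases n with
    | zero =>
      refine ext_one_subsingleton _ _ Subtype.val_injective (d.π_surjective l) (d.exact_ker l)
        (d.nabla β) fun k => ?_
      obtain ⟨F, hF⟩ := d.exists_extension l β k
      exact ⟨F, LinearMap.ext hF⟩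
    | succ n =>
      have := (d.ker_filt l).ext_subsingleton (d.nabla β) (n + 1) fun μ hμ =>
        ih _ (d.rank_lt hμ) μ n rfl
      exact ext_succ_subsingleton _ _ Subtype.val_injective (d.π_surjective l) (d.exact_ker l)
        (d.nabla β) (n + 1)

/-- Morphisms of modules and elements of `Ext⁰`. -/
noncomputable def extZeroEquiv (X Y : ModuleCat.{u} A) : Ext X Y 0 ≃ₗ[R] (X →ₗ[A] Y) :=
  Ext.linearEquiv₀ ≪≫ₗ ModuleCat.homLinearEquiv

/-- The maps from a standard to the corresponding costandard module are the multiples of the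
canonical one. -/
noncomputable def homNablaEquiv (l : Λ) : R ≃ₗ[R] (Δ l →ₗ[A] d.nabla l) :=
  LinearEquiv.ofBijective (LinearMap.toSpanSingleton R (Δ l →ₗ[A] d.nabla l) (d.canon l)) (by
    have hs : ∀ (r : R) (x : Δ l) (e : d.E l), app (d := d) (l := l)
        (LinearMap.toSpanSingleton R (Δ l →ₗ[A] d.nabla l) (d.canon l) r x) e =
          r * app (d.canon l x) e := fun r x e => by
      rw [← app_algebraMap_smul]
      rfl
    constructor
    · rw [injective_iff_map_eq_zero]
      intro r hr
      refine d.eq_zero_of_smul_canon l fun x e => ?_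
      rw [← hs, hr]
      rfl
    · intro g
      obtain ⟨r, hr⟩ := d.exists_eq_smul_canon l g
      refine ⟨r, LinearMap.ext fun x => Nabla.ext (d := d) fun e => ?_⟩
      rw [hs, ← app_algebraMap_smul]
      exact congrArg (fun v : d.Nabla l => app v e) (congrFun hr x).symm)

theorem isCostandard [Finite Λ] (hN : IsNoetherianRing R) [Module.Finite R A]
    [Module.Projective R A] : IsCostandard R Δ d.nabla where
  opposite := d.isSplitQuasiHereditary_op hN _ d.dualNablaEquiv
  ext_equiv l := ⟨extZeroEquiv _ _ ≪≫ₗ (d.homNablaEquiv l).symm⟩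
  ext_zero l β i hi := by
    cases i with
    | zero => exact ext_zero_subsingleton _ _ (d.hom_nabla_eq_zero fun h => hi ⟨rfl, h⟩)
    | succ n => exact d.ext_nabla_succ l β n

end SplitData

end SplitQH

namespace SplitQH

/-! ### Uniqueness of the costandard modules -/

section Five

open Abelian

variable {A : Type u} [Ring A] {Λ : Type w} {Δ : Λ → ModuleCat.{u} A}

/-- A map inducing bijections on `Hom(Δ μ, -)` induces bijections on `Hom(M, -)` for filtered
modules `M`, provided `Ext¹(Δ μ, -)` vanishes on its source. -/
lemma Filt.hom_bijective {S : Set Λ} {M : Type u} [AddCommGroup M] [Module A M]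
    (h : Filt Δ S M) {Y Z : ModuleCat.{u} A} (φ : Y →ₗ[A] Z)
    (hext : ∀ μ, Subsingleton (Ext (Δ μ) Y 1))
    (hφ : ∀ μ, Function.Bijective fun k : Δ μ →ₗ[A] Y => φ ∘ₗ k) :
    Function.Bijective fun k : M →ₗ[A] Y => φ ∘ₗ k := by
  induction h with
  | zero M h =>
    have : ∀ W : ModuleCat.{u} A, Subsingleton (M →ₗ[A] W) := fun W =>
      ⟨fun f g => by ext y; rw [Subsingleton.elim y 0, map_zero, map_zero]⟩
    exact ⟨Function.injective_of_subsingleton _, fun k => ⟨0, Subsingleton.elim _ _⟩⟩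
  | @ext M' M M'' _ _ _ _ _ _ f g hf hg hfg μ hμ h'' h' ih =>
    have hb : Function.Bijective fun k : M'' →ₗ[A] Y => φ ∘ₗ k := by
      obtain ⟨m, i, p, hp⟩ := h''
      constructor
      · intro k k' hk
        ext y
        rw [← hp y, map_sum, map_sum]
        refine Finset.sum_congr rfl fun s _ => ?_
        exact LinearMap.congr_fun ((hφ μ).1 (a₁ := k ∘ₗ p s) (a₂ := k' ∘ₗ p s)
          (congrArg (fun q => q ∘ₗ p s) hk)) (i s y)
      · intro k
        choose q hq using fun s => (hφ μ).2 (k ∘ₗ p s)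
        refine ⟨∑ s, q s ∘ₗ i s, ?_⟩
        ext y
        have hq' : ∀ s y, φ (q s y) = k (p s y) := fun s => LinearMap.congr_fun (hq s)
        simp only [LinearMap.comp_apply, LinearMap.sum_apply, map_sum, hq']
        rw [← map_sum, hp]
    have : Subsingleton (Ext (ModuleCat.of A M'') Y 1) := by
      have := hext μ
      exact IsSumRetract.ext_subsingleton (X := Δ μ) (N := ModuleCat.of A M'') h'' 1
    constructor
    · intro k k' hk
      have h1 : (k - k') ∘ₗ f = 0 := ih.1 (by
        ext y
        have := LinearMap.congr_fun hk (f y)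
        simpa [sub_eq_zero] using this)
      obtain ⟨q, hq⟩ := exists_desc_of_surjective g hg (k - k') fun y hy => by
        obtain ⟨x, rfl⟩ := (hfg y).1 hy
        exact LinearMap.congr_fun h1 x
      have hq0 : q = 0 := hb.1 (by
        ext y
        obtain ⟨y, rfl⟩ := hg y
        have h2 : q (g y) = (k - k') y := LinearMap.congr_fun hq y
        have := LinearMap.congr_fun hk y
        simpa [h2, sub_eq_zero] using this)
      rw [hq0, LinearMap.zero_comp] at hq
      exact sub_eq_zero.1 hq.symm
    · intro k
      obtain ⟨q, hq⟩ := ih.2 (k ∘ₗ f)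
      -- The lift over `M'` extends to `M` since Ext¹(M'', Y) = 0; its discrepancy with `k` factors
      -- through `M''` and is corrected there.
      obtain ⟨q', rfl⟩ := exists_extension_of_ext f g hf hg hfg Y q
      obtain ⟨r, hr⟩ := exists_desc_of_surjective g hg (k - φ ∘ₗ q') fun y hy => by
        obtain ⟨x, rfl⟩ := (hfg y).1 hy
        have : φ (q' (f x)) = k (f x) := LinearMap.congr_fun hq x
        simp [this]
      obtain ⟨r', rfl⟩ := hb.2 r
      refine ⟨q' + r' ∘ₗ g, ?_⟩
      ext y
      have : φ (r' (g y)) = k y - φ (q' y) := LinearMap.congr_fun hr y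
      simp [this]

end Five

namespace SplitData

open Abelian Nabla MulOpposite

variable {R : Type u} [CommRing R] {A : Type u} [Ring A] [Algebra R A]
  {Λ : Type w} [PartialOrder Λ] {Δ : Λ → ModuleCat.{u} A} (d : SplitData R Δ)

/-- A module with the same `Ext`-orthogonality properties as a costandard module is isomorphic
to it. -/
theorem nonempty_nabla_equiv (l : Λ) (Y : ModuleCat.{u} A)
    (h0 : ∀ μ, μ ≠ l → ∀ f : Δ μ →ₗ[A] Y, f = 0) (ε : (Δ l →ₗ[A] Y) ≃ₗ[R] R)
    (hext : ∀ μ, Subsingleton (Ext (Δ μ) Y 1)) : Nonempty (d.nabla l ≃ₗ[A] Y) := by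
  have hY : tower Δ d.rank Y (d.rank l) = ⊥ := tower_eq_bot fun μ hμ => h0 μ fun he => by
    subst he; omega
  let φ : Y →ₗ[A] d.Nabla l :=
    { toFun := fun y => ε.toLinearMap ∘ₗ homMap R (Δ l) (TowerQuot.act hY y)
      map_add' := fun x y => Nabla.ext fun e => by
        change ε (TowerQuot.act hY (x + y) ∘ₗ e) =
          ε (TowerQuot.act hY x ∘ₗ e) + ε (TowerQuot.act hY y ∘ₗ e)
        rw [TowerQuot.act_add, LinearMap.add_comp, map_add]
      map_smul' := fun a x => Nabla.ext fun e => by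
        change ε (TowerQuot.act hY (a • x) ∘ₗ e) = ε (TowerQuot.act hY x ∘ₗ (op a • e))
        congr 1
        ext y
        exact (TowerQuot.act_op_smul hY x a (e y)).symm }
  -- Naturality of the action: acting on h(x) is h applied to the action on x, and the latter
  -- composed with `e` is a scalar endomorphism of Δ(l). Thus φ ∘ h is ε(h) times the canonical map.
  have hφ : ∀ (h : Δ l →ₗ[A] Y) (x : Δ l) (e : d.E l),
      app (φ (h x)) e = ε h * app (d.canon l x) e := fun h x e => by
    change ε (TowerQuot.act hY (h x) ∘ₗ e) = _
    have : TowerQuot.act hY (h x) ∘ₗ e = app (d.canon l x) e • h := by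
      ext y
      rw [LinearMap.comp_apply, ← TowerQuot.map_act (d.tower_std l) hY, ← canon_smul,
        LinearMap.smul_apply, LinearMap.map_smul_of_tower]
    rw [this, map_smul, smul_eq_mul, mul_comm]
  have hbij : ∀ μ, Function.Bijective fun k : Δ μ →ₗ[A] Y => φ ∘ₗ k := by
    intro μ
    by_cases hμ : μ = l
    · subst hμ
      constructor
      · intro k k' hk
        rw [← sub_eq_zero]
        refine ε.injective ?_
        rw [map_zero]
        refine d.eq_zero_of_smul_canon μ fun x e => ?_
        rw [← hφ, LinearMap.sub_apply, map_sub,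
          show φ (k x) = φ (k' x) from LinearMap.congr_fun hk x, sub_self, app_zero]
      · intro g
        obtain ⟨r, hr⟩ := d.exists_eq_smul_canon μ g
        refine ⟨ε.symm r, LinearMap.ext fun x => Nabla.ext fun e => ?_⟩
        rw [LinearMap.comp_apply, hφ, ε.apply_symm_apply, congrFun hr x, Pi.smul_apply,
          app_algebraMap_smul]
    · exact ⟨fun k k' _ => (h0 μ hμ k).trans (h0 μ hμ k').symm, fun g =>
        ⟨0, by rw [d.hom_nabla_eq_zero hμ g]; exact LinearMap.comp_zero φ⟩⟩
  -- An element of a module is a map from A, and A is a summand of a finite sum of P(μ)'s, so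
  -- bijectivity on Hom(P(μ), -) gives bijectivity of `φ` itself.
  have hP := fun μ => (d.P_filt μ).hom_bijective (Z := d.nabla l) φ hext hbij
  obtain ⟨m, μ, i, p, hp⟩ := d.exists_sum
  refine ⟨(LinearEquiv.ofBijective φ ⟨?_, fun n => ?_⟩).symm⟩
  · rw [injective_iff_map_eq_zero]
    intro y hy
    rw [← one_smul A y, ← hp 1, Finset.sum_smul]
    refine Finset.sum_eq_zero fun s _ => ?_
    have : LinearMap.toSpanSingleton A Y y ∘ₗ p s = 0 := (hP (μ s)).1 (by
      refine LinearMap.ext fun x => ?_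
      change φ (p s x • y) = φ 0
      rw [map_smul, hy, smul_zero, map_zero])
    exact LinearMap.congr_fun this (i s 1)
  · choose q hq using fun s => (hP (μ s)).2 (LinearMap.toSpanSingleton A (d.Nabla l) n ∘ₗ p s)
    refine ⟨∑ s, q s (i s 1), ?_⟩
    rw [map_sum]
    conv_rhs => rw [← one_smul A n, ← hp 1, Finset.sum_smul]
    exact Finset.sum_congr rfl fun s _ => LinearMap.congr_fun (hq s) (i s 1)

theorem nonempty_equiv_of_isCostandard {nabla' : Λ → ModuleCat.{u} A}
    (h : IsCostandard R Δ nabla') (l : Λ) : Nonempty (d.nabla l ≃ₗ[A] nabla' l) := by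
  refine d.nonempty_nabla_equiv l (nabla' l) (fun μ hμ f => ?_)
    ((extZeroEquiv _ _).symm ≪≫ₗ (h.ext_equiv l).some) fun μ => h.ext_zero μ l 1 (by simp)
  have := h.ext_zero μ l 0 (by simp [hμ])
  exact hom_eq_zero_of_ext _ _ f

end SplitData

/-! ### The zero ring and the theorem -/

section Trivial

variable {R : Type u} [CommRing R] [Subsingleton R]

lemma IsSplitQuasiHereditary.of_subsingleton {B : Type u} [Ring B] [Algebra R B] {Λ : Type w}
    [PartialOrder Λ] (X : Λ → ModuleCat.{u} B) : IsSplitQuasiHereditary R X := by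
  have hB : Subsingleton B := Algebra.subsingleton R B
  have hX : ∀ M : ModuleCat.{u} B, Subsingleton M := fun M => Module.subsingleton B M
  have : ∀ l, Subsingleton (Module.End B (X l)) := fun l =>
    ⟨fun f g => by ext x; exact (hX (X l)).elim _ _⟩
  refine ⟨inferInstance, inferInstance, inferInstance, fun l => ?_, fun l => ?_,
    fun l μ ⟨f, hf⟩ => ?_, fun l => ⟨?_⟩, X, fun l => ?_, fun Q => ?_⟩
  · have := hX (X l); infer_instance
  · have := hX (X l); infer_instance
  · exact absurd (by ext x; exact (hX (X μ)).elim _ _) hf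
  · exact (AlgEquiv.ofBijective (Algebra.ofId R _)
      ⟨Function.injective_of_subsingleton _, fun f => ⟨0, Subsingleton.elim _ _⟩⟩).symm
  · have := hX (X l)
    have := Module.Free.of_subsingleton B (X l)
    exact ⟨inferInstance, Module.Projective.of_free, LinearMap.id, Function.surjective_id, 0, fun _ => ⊥,
      monotone_const, rfl, Subsingleton.elim _ _, fun i hi => absurd hi (by omega)⟩
  · have := hX Q
    have := Module.Free.of_subsingleton B Q
    exact ⟨fun _ => ⟨inferInstance, Module.Projective.of_free⟩, fun _ =>
      ⟨0, 0, 0, by ext x; exact Subsingleton.elim _ _⟩⟩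

end Trivial

end SplitQH

theorem mainTheorem8 (R : Type u) [CommRing R] (A : Type u) [Ring A] [Algebra R A]
    (Λ : Type w) [PartialOrder Λ] (Δ : Λ → ModuleCat.{u} A)
    (hΔ : SplitQH.IsSplitQuasiHereditary R Δ) :
    ∃ nabla : Λ → ModuleCat.{u} A,
      (∀ l, Module.Finite A (nabla l)) ∧ SplitQH.IsCostandard R Δ nabla ∧
      ∀ nabla' : Λ → ModuleCat.{u} A, SplitQH.IsCostandard R Δ nabla' →
        ∀ l, Nonempty (nabla l ≃ₗ[A] nabla' l) := by
  -- Over the zero ring Λ may be infinite, so the numbering is unavailable; but every module and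
  -- every Ext group is then zero.
  rcases subsingleton_or_nontrivial R with hR | hR
  · have hA : Subsingleton A := Algebra.subsingleton R A
    have hX : ∀ M : ModuleCat.{u} A, Subsingleton M := fun M => Module.subsingleton A M
    have hE : ∀ (X Y : ModuleCat.{u} A) (n : ℕ), Subsingleton (Abelian.Ext X Y n) :=
      fun X Y n => SplitQH.ext_subsingleton_of_subsingleton X Y n
    exact ⟨Δ, hΔ.finite, ⟨.of_subsingleton _, fun l => ⟨
      { toFun := fun _ => 0
        invFun := fun _ => 0
        left_inv := fun _ => (hE _ _ _).elim _ _
        right_inv := fun _ => Subsingleton.elim _ _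
        map_add' := fun _ _ => Subsingleton.elim _ _
        map_smul' := fun _ _ => Subsingleton.elim _ _ }⟩, fun _ _ _ _ => hE _ _ _⟩,
      fun nabla' _ l => ⟨
      { toFun := fun _ => 0
        invFun := fun _ => 0
        left_inv := fun _ => (hX _).elim _ _
        right_inv := fun _ => (hX _).elim _ _
        map_add' := fun _ _ => (hX _).elim _ _
        map_smul' := fun _ _ => (hX _).elim _ _ }⟩⟩
  · have := hΔ.finite_index
    have := hΔ.algebra_finite
    have := hΔ.algebra_projective
    obtain ⟨d⟩ := hΔ.nonempty_splitData
    exact ⟨d.nabla, d.nabla_finite, d.isCostandard hΔ.noetherian,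
      fun nabla' h l => d.nonempty_equiv_of_isCostandard h l⟩
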